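/- **Setting.** Let $h:\mathbb R^d\to\mathbb R^d$ be $L$-Lipschitz, and let $\mathbb R^d$-valued random variables satisfy $x_{n+1}=x_n+a(n)[h(x_n)+M_{n+1}]$ for $n\ge 0$. Put $\mathcal F_n=\sigma(x_0,M_1,\dots,M_n)$, $t(n)=\sum_{i<n}a(i)$ and $b(n)=\sum_{m\ge n}a(m)^2$. Assume: * (step sizes) $a(n)>0$, $\sum_n a(n)=\infty$, $\sum_n a(n)^2<\infty$, and for some constant $c>0$, $a(n)\le c\,a(m)$ whenever $n\ge m$; * (noise) every $M_{n+1}$, $n\ge 0$, is square integrable, $E[M_{n+1}\mid\mathcal F_n]=0$ a.s., and for some constant $c>0$, $E[\|M_{n+1}\|^2\mid\mathcal F_n]\le c(1+\|x_n\|^2)$ a.s. for all $n$; * (tail) there are constants $C_1,C_2>0$ such that for all sufficiently large $v$ and all $i\ge 0$, $P\big[\|M_{i+1}\|/(1+\|x_i\|)>v\mid\mathcal F_i\big]\le C_1e^{-C_2v}$ a.s.; * (Lipschitz step sizes) $T>0$ is fixed, $n^+_T:=\min\{m: t(m)\ge t(n)+T\}$, and there is a constant $\gamma_T>0$ such that $a(k)/a(l)<\gamma_T$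 for all $n\ge 0$ and all $k,l\in[n,n^+_T)$. Let $G\subseteq\mathbb R^d$ be open (for instance $G=\mathbb R^d$) and let $V:G\to[0,\infty)$ be differentiable, with compact sublevel sets $\{x\in G: V(x)\le r\}$ for all $r$ (for $G=\mathbb R^d$ this means $V(x)\to\infty$ as $\|x\|\to\infty$), and with $\nabla V\cdot h\le 0$ on $G$. Assume that $H:=\{x\in G:\nabla V(x)\cdot h(x)=0\}$ equals $\{x\in G: V(x)=0\}$. Let $B$ be a bounded open set with $H\subseteq B$ and $\overline B\subseteq G$. For a sequence $y=(y_n)$ in $\mathbb R^d$ let $\bar y$ be the piecewise linear path with $\bar y(t(n))=y_n$. For $S>0$ let $\rho_n^S(y)$ be the supremum of $\|\bar y(t)-\varphi(t)\|$ over $t\in[t(n),t(n^+_S))$, where $\varphi$ is the solution of $\dot\varphi=h(\varphi)$ with $\varphi(t(n))=y_n$. Say that $\delta_B>0$ is *admissible* for $S$ if for every sequence $y$ and every $n$, $y_n\in B$ and $\rho^S_n(y)<\delta_B$ imply $y_{n^+_S}\in B$. Write $x_n\to H$ for $\mathrm{dist}(x_n,H)\to0$, and let $K_T=e^{L(T+1)}$.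 **Theorem (lock-in probability).** 1. There are constants $c,c_1>0$ such that for every $\delta_B$ admissible for $T$, with $\delta=\delta_B/(2K_T)$, and for all sufficiently large $n_0$ with $P[x_{n_0}\in B]>0$, $$P[x_n\to H\mid x_{n_0}\in B]\ \ge\ 1-c_1\exp\!\left(-\frac{c\,\delta^{2/3}}{b(n_0)^{1/4}}\right).$$ 2. There is $T_0>0$ such that for every $S\ge T_0$ some $\delta_B>0$ is admissible for $S$. 3. Whatever the value of $T$, there are $c,c_1>0$ such that for all sufficiently large $n_0$ with $P[x_{n_0}\in B]>0$, $P[x_n\to H\mid x_{n_0}\in B]\ge 1-c_1\exp\big(-c/b(n_0)^{1/4}\big)$. -/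

import Mathlib

open MeasureTheory ProbabilityTheory Filter Topology
open scoped NNReal

namespace StochApprox

/-- The state space `ℝ^d` with its Euclidean norm. -/
abbrev Space (d : ℕ) : Type := EuclideanSpace ℝ (Fin d)

/-- The elapsed time `t(n) = a(0) + ⋯ + a(n-1)`. -/
def time (a : ℕ → ℝ) (n : ℕ) : ℝ := ∑ i ∈ Finset.range n, a i

/-- `b(n) = ∑_{m ≥ n} a(m)^2`. -/
noncomputable def tailSq (a : ℕ → ℝ) (n : ℕ) : ℝ := ∑' m : ℕ, a (n + m) ^ 2

/-- The start of the block following the one that starts at `n`: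
`min {m : t(m) ≥ t(n) + T}`. Thus `n_{i+1} = nextIndex a T n_i`. -/
noncomputable def nextIndex (a : ℕ → ℝ) (T : ℝ) (n : ℕ) : ℕ :=
  sInf {m : ℕ | time a n + T ≤ time a m}

/-- Step size assumptions: positivity, divergent sum, summable squares, and
`a(n) ≤ c a(m)` for all `n ≥ m`. -/
structure IsStepSize (a : ℕ → ℝ) : Prop where
  pos : ∀ n, 0 < a n
  not_summable : ¬ Summable a
  summable_sq : Summable fun n => a n ^ 2
  almost_antitone : ∃ c : ℝ, 0 < c ∧ ∀ m n, m ≤ n → a n ≤ c * a m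

/-- Two step sizes from one block `[t(n_i), t(n_{i+1}))` have ratio less than `γ`. Every `n` is
allowed as the initial index `n_0`, so the block starts `n_i` range over all `n`. -/
def LipschitzSteps (a : ℕ → ℝ) (T γ : ℝ) : Prop :=
  ∀ n m₁ m₂ : ℕ, n + m₁ < nextIndex a T n → n + m₂ < nextIndex a T n →
    a (n + m₁) / a (n + m₂) < γ

/-- `F_n = σ(x_0, M_1, …, M_n)`. -/
abbrev history {Ω : Type*} {d : ℕ} (x M : ℕ → Ω → Space d) (n : ℕ) : MeasurableSpace Ω :=
  MeasurableSpace.comap (x 0) inferInstance ⊔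
    ⨆ k ∈ Finset.Icc 1 n, MeasurableSpace.comap (M k) inferInstance

/-- `(M_n)_{n ≥ 1}` is a square integrable martingale difference sequence with respect to
`F_n = σ(x_0, M_1, …, M_n)` and `E[‖M_{n+1}‖² | F_n] ≤ K (1 + ‖x_n‖²)` for some constant `K`. -/
structure IsNoise {Ω : Type*} [MeasurableSpace Ω] (μ : Measure Ω) {d : ℕ}
    (x M : ℕ → Ω → Space d) : Prop where
  measurable_init : Measurable (x 0)
  measurable : ∀ n, Measurable (M (n + 1))
  memLp : ∀ n, MemLp (M (n + 1)) 2 μ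
  condExp_eq_zero : ∀ n, μ[M (n + 1) | history x M n] =ᵐ[μ] 0
  condExp_sq_le : ∃ K : ℝ, 0 < K ∧ ∀ n,
    μ[fun ω => ‖M (n + 1) ω‖ ^ 2 | history x M n] ≤ᵐ[μ] fun ω => K * (1 + ‖x n ω‖ ^ 2)

/-- `P[‖M_{i+1}‖ / (1 + ‖x_i‖) > v | F_i] ≤ C₁ exp(-C₂ v)` for all `i` and all large `v`. -/
def ExpTail {Ω : Type*} [MeasurableSpace Ω] (μ : Measure Ω) {d : ℕ}
    (x M : ℕ → Ω → Space d) (C₁ C₂ : ℝ) : Prop :=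
  ∃ v₀ : ℝ, ∀ v : ℝ, v₀ ≤ v → ∀ i : ℕ,
    μ[{ω | v < ‖M (i + 1) ω‖ / (1 + ‖x i ω‖)}.indicator (fun _ => (1 : ℝ)) | history x M i]
      ≤ᵐ[μ] fun _ => C₁ * Real.exp (-C₂ * v)

/-- `{x ∈ G : ∇V(x) · h(x) = 0}`. -/
def stationarySet {d : ℕ} (h : Space d → Space d) (G : Set (Space d)) (V : Space d → ℝ) :
    Set (Space d) :=
  {x ∈ G | inner ℝ (gradient V x) (h x) = 0}

/-- `V` is a Liapunov function of `x' = h(x)` on the open set `G`: it is differentiable and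
nonnegative on `G`, it tends to infinity at the boundary of `G` and at infinity (that is, its
sublevel sets in `G` are compact), it satisfies `∇V · h ≤ 0` on `G`, and `∇V · h` and `V` vanish
at the same points of `G`. For `G = ℝ^d` the compactness condition says that `V(x) → ∞` as
`‖x‖ → ∞`. -/
structure IsLiapunov {d : ℕ} (h : Space d → Space d) (G : Set (Space d)) (V : Space d → ℝ) :
    Prop where
  isOpen : IsOpen G
  differentiableOn : DifferentiableOn ℝ V G
  nonneg : ∀ x ∈ G, 0 ≤ V x
  proper : ∀ r : ℝ, IsCompact {x ∈ G | V x ≤ r}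
  decreasing : ∀ x ∈ G, inner ℝ (gradient V x) (h x) ≤ 0
  stationary_eq : stationarySet h G V = {x ∈ G | V x = 0}

/-- The piecewise linear path with value `y n` at time `t(n)`: if `t(k) ≤ s < t(k+1)`, its value
at `s` is the corresponding point of the segment from `y k` to `y (k+1)`. -/
noncomputable def interpolate {d : ℕ} (a : ℕ → ℝ) (y : ℕ → Space d) (s : ℝ) : Space d :=
  let k := sInf {k : ℕ | s < time a (k + 1)}
  y k + ((s - time a k) / a k) • (y (k + 1) - y k)

/-- `φ` solves `x' = h(x)` on the block `[t(n), t(n'))`, where `n'` is the next block start, with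
initial value `y₀` at time `t(n)`. -/
def SolvesOnBlock {d : ℕ} (h : Space d → Space d) (a : ℕ → ℝ) (T : ℝ) (n : ℕ) (y₀ : Space d)
    (φ : ℝ → Space d) : Prop :=
  φ (time a n) = y₀ ∧
    ∀ s ∈ Set.Ico (time a n) (time a (nextIndex a T n)),
      HasDerivWithinAt φ (h (φ s)) (Set.Ico (time a n) (time a (nextIndex a T n))) s

/-- The largest distance over the block starting at `n` between the interpolated path of `y` and
the path `φ`. With `n = n_i` and `φ` the solution of the o.d.e. from `y n_i`, this is `ρ_i`. -/
noncomputable def blockDeviation {d : ℕ} (a : ℕ → ℝ) (T : ℝ) (y : ℕ → Space d) (n : ℕ)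
    (φ : ℝ → Space d) : ℝ :=
  sSup ((fun s => ‖interpolate a y s - φ s‖) ''
    Set.Ico (time a n) (time a (nextIndex a T n)))

/-- The defining property of `δ_B`: whenever a sequence is in `B` at the start of a block and
`ρ < δ_B` on the block, it is in `B` at the start of the next block. -/
def Traps {d : ℕ} (h : Space d → Space d) (a : ℕ → ℝ) (T : ℝ) (B : Set (Space d)) (δB : ℝ) :
    Prop :=
  ∀ (y : ℕ → Space d) (n : ℕ) (φ : ℝ → Space d), SolvesOnBlock h a T n (y n) φ →
    y n ∈ B → blockDeviation a T y n φ < δB → y (nextIndex a T n) ∈ B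

/-- The Gronwall constant `K_T = exp(L (T + 1))` of an `L`-Lipschitz vector field. -/
noncomputable def gronwallConst (L : ℝ≥0) (T : ℝ) : ℝ := Real.exp (L * (T + 1))

/-- The event that `x_n → H`. -/
def convergesTo {Ω : Type*} {d : ℕ} (x : ℕ → Ω → Space d) (H : Set (Space d)) : Set Ω :=
  {ω | Tendsto (fun n => Metric.infDist (x n ω) H) atTop (𝓝 0)}

end StochApprox

/-! While the iterates stay in a ball of radius `R`, the tail hypothesis makes the noise
conditionally subexponential with constants uniform in time. Set the noise to zero whenever ‖x_k‖ >
`R`. A Chernoff argument with an exponential supermartingale, run once from n₀ to infinity rather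
than block by block, gives P[some partial sum of a(k)M_{k+1} from n₀ on reaches ε | x_{n₀} ∈ B] ≤ C
exp(-κε/√b(n₀)) (`exists_truncatedNoise_bound`).

If all these partial sums stay below a small ε, the rest is pathwise. A discrete Gronwall estimate
(`norm_sub_flow_le`) keeps each block close to the flow, so the trapping property returns the path
to B at every block start and the ball is never left (`Traps.exists_trapping_constants`). Hence the
truncation was never active. The noise tails almost surely vanish (`ae_exists_truncatedNoise_le`),
so the path follows the flow ever more closely, and `V` decreases until it is below any given level
(`IsLiapunov.tendsto_infDist`).

The resulting error exp(-κ/√b), with κ depending on δ_B, is stronger than the one claimed: √b is the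
square of b^{1/4}, so for large n₀ it is below exp(-q/b^{1/4}) for every q
(`IsStepSize.exists_exp_tailSq_le`). The index from which the bound holds may depend on δ_B, and
this absorbs the factor δ^{2/3}. -/

namespace StochApprox

/-! ### The global forward flow of a Lipschitz vector field -/

section Flow

/-- `φ` solves `x' = h(x)` on `[0, ∞)`. -/
def IsForwardSolution {d : ℕ} (h : Space d → Space d) (φ : ℝ → Space d) : Prop :=
  ∀ t, 0 ≤ t → HasDerivWithinAt φ (h (φ t)) (Set.Ici 0) t

/-- Coordinatewise truncation to `[-R, R]^d`. -/
noncomputable def clamp {d : ℕ} (R : ℝ) (x : Space d) : Space d :=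
  WithLp.toLp 2 fun i => max (-R) (min R (x i))

theorem clamp_lipschitz {d : ℕ} (R : ℝ) : LipschitzWith 1 (clamp (d := d) R) := by
  refine LipschitzWith.of_dist_le_mul fun x y => ?_
  rw [NNReal.coe_one, one_mul, EuclideanSpace.dist_eq, EuclideanSpace.dist_eq]
  refine Real.sqrt_le_sqrt (Finset.sum_le_sum fun i _ => ?_)
  have : dist (clamp R x i) (clamp R y i) ≤ dist (x i) (y i) := by
    simp only [clamp, Real.dist_eq]
    calc |max (-R) (min R (x i)) - max (-R) (min R (y i))|
        ≤ max |(-R) - (-R)| |min R (x i) - min R (y i)| := abs_max_sub_max_le_max _ _ _ _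
      _ ≤ |min R (x i) - min R (y i)| := by simp
      _ ≤ max |R - R| |x i - y i| := abs_min_sub_min_le_max _ _ _ _
      _ ≤ |x i - y i| := by simp
  exact pow_le_pow_left₀ dist_nonneg this 2

theorem norm_clamp_le {d : ℕ} {R : ℝ} (hR : 0 ≤ R) (x : Space d) : ‖clamp R x‖ ≤ ‖x‖ := by
  have h0 : clamp R (0 : Space d) = 0 := by
    ext i; simp [clamp, hR]
  simpa [h0] using (clamp_lipschitz R).dist_le_mul x 0

theorem norm_clamp_le_const {d : ℕ} {R : ℝ} (hR : 0 ≤ R) (x : Space d) :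
    ‖clamp R x‖ ≤ Real.sqrt (d * R ^ 2) := by
  rw [EuclideanSpace.norm_eq]
  refine Real.sqrt_le_sqrt ?_
  have : ∀ i, ‖clamp R x i‖ ^ 2 ≤ R ^ 2 := fun i => by
    rw [Real.norm_eq_abs]
    refine pow_le_pow_left₀ (abs_nonneg _) (abs_le.2 ⟨le_max_left _ _, ?_⟩) 2
    exact max_le (by linarith) (min_le_left _ _)
  simpa using Finset.sum_le_sum fun i (_ : i ∈ Finset.univ) => this i

theorem clamp_eq_self {d : ℕ} {R : ℝ} {x : Space d} (hx : ‖x‖ ≤ R) : clamp R x = x := by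
  ext i
  have h1 : |x i| ≤ R := le_trans (by simpa using PiLp.norm_apply_le x i) hx
  have := abs_le.1 h1
  simp [clamp, min_eq_right this.2, max_eq_right this.1]

theorem norm_le_of_lipschitz {d : ℕ} {h : Space d → Space d} {L : ℝ≥0} (hL : LipschitzWith L h)
    (x : Space d) : ‖h x‖ ≤ L * ‖x‖ + ‖h 0‖ := by
  have h1 := hL.dist_le_mul x 0
  rw [dist_zero_right, dist_eq_norm] at h1
  linarith [norm_le_norm_add_norm_sub' (h x) (h 0)]

theorem hasDerivWithinAt_Ici_of_Icc {d : ℕ} {φ : ℝ → Space d} {v : Space d} {N t : ℝ}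
    (ht : t ∈ Set.Ico 0 N) (h : HasDerivWithinAt φ v (Set.Icc 0 N) t) :
    HasDerivWithinAt φ v (Set.Ici t) t :=
  h.mono_of_mem_nhdsWithin <| by
    refine mem_of_superset (Icc_mem_nhdsGE ht.2) (Set.Icc_subset_Icc ht.1 le_rfl)

/-- Picard–Lindelöf on all of `[0, N]` needs a bounded field. Composing `h` with `clamp R` makes it
bounded without raising the Lipschitz constant. With `R` the Gronwall bound coming from linear
growth alone, the solution never meets the truncation. -/
theorem exists_solution_Icc {d : ℕ} {h : Space d → Space d} {L : ℝ≥0} (hL : LipschitzWith L h)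
    (x : Space d) (N : ℕ) : ∃ φ : ℝ → Space d, φ 0 = x ∧
      ∀ t ∈ Set.Icc (0 : ℝ) N, HasDerivWithinAt φ (h (φ t)) (Set.Icc 0 N) t := by
  set R : ℝ := gronwallBound ‖x‖ L ‖h 0‖ N with hR
  have hR0 : 0 ≤ R := by
    have := gronwallBound_mono (norm_nonneg x) (norm_nonneg (h 0)) L.2 (Nat.cast_nonneg (α := ℝ) N)
    rw [gronwallBound_x0] at this
    exact (norm_nonneg x).trans this
  set f : Space d → Space d := fun y => h (clamp R y) with hf
  have hfL : LipschitzWith L f := by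
    have := hL.comp (clamp_lipschitz (d := d) R)
    rwa [mul_one] at this
  set C : ℝ≥0 := ⟨L * Real.sqrt (d * R ^ 2) + ‖h 0‖, by positivity⟩ with hC
  have hfC : ∀ y, ‖f y‖ ≤ C := fun y =>
    (norm_le_of_lipschitz hL _).trans <| by
      change _ ≤ L * Real.sqrt (d * R ^ 2) + ‖h 0‖
      gcongr
      exact norm_clamp_le_const hR0 y
  -- Speed at most `C` for time at most `N` keeps the curve in the ball of radius `C * N`.
  have hpl : IsPicardLindelof (fun _ => f) (⟨0, by simp⟩ : Set.Icc (0 : ℝ) N) x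
      (C * N) 0 C L := by
    refine IsPicardLindelof.of_time_independent (fun y _ => hfC y) hfL.lipschitzOnWith ?_
    simp
  obtain ⟨φ, hφ0, hφ⟩ := hpl.exists_eq_forall_mem_Icc_hasDerivWithinAt₀
  refine ⟨φ, hφ0, fun t ht => ?_⟩
  have hb := norm_le_gronwallBound_of_norm_deriv_right_le (f := φ) (f' := fun t => f (φ t))
    (δ := ‖x‖) (K := L) (ε := ‖h 0‖) (a := 0) (b := N)
    (fun t ht => (hφ t ht).continuousWithinAt)
    (fun t ht => hasDerivWithinAt_Ici_of_Icc ht (hφ t ⟨ht.1, ht.2.le⟩)) (by rw [← hφ0])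
    (fun t _ => (norm_le_of_lipschitz hL _).trans (by gcongr; exact norm_clamp_le hR0 _)) t ht
  have hle : ‖φ t‖ ≤ R := hb.trans <| by
    rw [sub_zero]
    exact gronwallBound_mono (norm_nonneg x) (norm_nonneg (h 0)) L.2 ht.2
  have := hφ t ht
  simpa only [hf, clamp_eq_self hle] using this

/-- Solutions on the intervals `[0, N]` agree by uniqueness and are glued. The index `⌈t⌉₊ + 1`
exceeds `t` strictly, so `[0, N]` is a neighbourhood of `t` within the half-line. -/
theorem exists_forwardSolution {d : ℕ} {h : Space d → Space d} {L : ℝ≥0} (hL : LipschitzWith L h)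
    (x : Space d) : ∃ φ : ℝ → Space d, φ 0 = x ∧ IsForwardSolution h φ := by
  choose σ hσ0 hσ using exists_solution_Icc hL x
  have huniq : ∀ m n : ℕ, ∀ t : ℝ, 0 ≤ t → t ≤ m → t ≤ n → σ m t = σ n t := by
    intro m n t h0 hm hn
    refine ODE_solution_unique (v := fun _ => h) (K := L) (a := 0) (b := t) (fun _ => hL)
      (fun s hs => ?_) (fun s hs => ?_) (fun s hs => ?_) (fun s hs => ?_) ?_ ⟨h0, le_rfl⟩
    · exact ((hσ m s ⟨hs.1, hs.2.trans hm⟩).continuousWithinAt).mono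
        (Set.Icc_subset_Icc le_rfl hm)
    · exact hasDerivWithinAt_Ici_of_Icc ⟨hs.1, hs.2.trans_le hm⟩
        (hσ m s ⟨hs.1, hs.2.le.trans hm⟩)
    · exact ((hσ n s ⟨hs.1, hs.2.trans hn⟩).continuousWithinAt).mono
        (Set.Icc_subset_Icc le_rfl hn)
    · exact hasDerivWithinAt_Ici_of_Icc ⟨hs.1, hs.2.trans_le hn⟩
        (hσ n s ⟨hs.1, hs.2.le.trans hn⟩)
    · rw [hσ0, hσ0]
  have hceil : ∀ t : ℝ, t < ((⌈t⌉₊ + 1 : ℕ) : ℝ) := fun t => by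
    push_cast; linarith [Nat.le_ceil t]
  refine ⟨fun t => σ (⌈t⌉₊ + 1) t, hσ0 _, fun t ht => ?_⟩
  set N := ⌈t⌉₊ + 1 with hN
  have hmem : Set.Icc (0 : ℝ) N ∈ 𝓝[Set.Ici 0] t := by
    rw [← Set.Ici_inter_Iic]
    exact inter_mem self_mem_nhdsWithin (mem_nhdsWithin_of_mem_nhds (Iic_mem_nhds (hceil t)))
  have h1 := (hσ N t ⟨ht, (hceil t).le⟩).mono_of_mem_nhdsWithin hmem
  refine h1.congr_of_eventuallyEq ?_ rfl
  filter_upwards [hmem] with s hs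
  exact huniq _ _ s hs.1 (hceil s).le hs.2

theorem IsForwardSolution.continuousOn {d : ℕ} {h : Space d → Space d} {φ : ℝ → Space d}
    (hφ : IsForwardSolution h φ) : ContinuousOn φ (Set.Ici 0) :=
  fun t ht => (hφ t ht).continuousWithinAt

theorem IsForwardSolution.hasDerivWithinAt_Ici {d : ℕ} {h : Space d → Space d} {φ : ℝ → Space d}
    (hφ : IsForwardSolution h φ) {t : ℝ} (ht : 0 ≤ t) :
    HasDerivWithinAt φ (h (φ t)) (Set.Ici t) t :=
  (hφ t ht).mono (Set.Ici_subset_Ici.2 ht)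

theorem IsForwardSolution.shift {d : ℕ} {h : Space d → Space d} {φ : ℝ → Space d}
    (hφ : IsForwardSolution h φ) {s : ℝ} (hs : 0 ≤ s) :
    IsForwardSolution h fun t => φ (s + t) := by
  intro t ht
  have h1 : HasDerivWithinAt (fun t : ℝ => s + t) 1 (Set.Ici 0) t :=
    ((hasDerivAt_id t).const_add s).hasDerivWithinAt
  have := (hφ (s + t) (by positivity)).scomp t h1
    (fun u (hu : 0 ≤ u) => show 0 ≤ s + u by positivity)
  rw [one_smul] at this
  exact this

theorem IsForwardSolution.dist_le {d : ℕ} {h : Space d → Space d} {L : ℝ≥0}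
    (hL : LipschitzWith L h) {φ ψ : ℝ → Space d} (hφ : IsForwardSolution h φ)
    (hψ : IsForwardSolution h ψ) {t : ℝ} (ht : 0 ≤ t) :
    dist (φ t) (ψ t) ≤ dist (φ 0) (ψ 0) * Real.exp (L * t) := by
  have := dist_le_of_trajectories_ODE (v := fun _ => h) (K := L) (f := φ) (g := ψ)
    (a := 0) (b := t) (δ := dist (φ 0) (ψ 0)) (fun _ => hL)
    (hφ.continuousOn.mono Set.Icc_subset_Ici_self) (fun s hs => hφ.hasDerivWithinAt_Ici hs.1)
    (hψ.continuousOn.mono Set.Icc_subset_Ici_self) (fun s hs => hψ.hasDerivWithinAt_Ici hs.1)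
    le_rfl t ⟨ht, le_rfl⟩
  simpa using this

theorem IsForwardSolution.norm_le {d : ℕ} {h : Space d → Space d} {L : ℝ≥0}
    (hL : LipschitzWith L h) {φ : ℝ → Space d} (hφ : IsForwardSolution h φ) {R S t : ℝ}
    (hR : ‖φ 0‖ ≤ R) (ht : 0 ≤ t) (htS : t ≤ S) :
    ‖φ t‖ ≤ gronwallBound R L ‖h 0‖ S := by
  have := norm_le_gronwallBound_of_norm_deriv_right_le (f := φ) (f' := fun t => h (φ t))
    (δ := R) (K := L) (ε := ‖h 0‖) (a := 0) (b := t)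
    (hφ.continuousOn.mono Set.Icc_subset_Ici_self) (fun s hs => hφ.hasDerivWithinAt_Ici hs.1)
    hR (fun s _ => norm_le_of_lipschitz hL _) t ⟨ht, le_rfl⟩
  rw [sub_zero] at this
  exact this.trans (gronwallBound_mono ((norm_nonneg _).trans hR) (norm_nonneg _) L.2 htS)

theorem IsForwardSolution.norm_sub_le {d : ℕ} {h : Space d → Space d} {φ : ℝ → Space d}
    (hφ : IsForwardSolution h φ) {C s t : ℝ} (hs : 0 ≤ s) (hst : s ≤ t)
    (hC : ∀ u ∈ Set.Ico s t, ‖h (φ u)‖ ≤ C) : ‖φ t - φ s‖ ≤ C * (t - s) :=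
  norm_image_sub_le_of_norm_deriv_right_le_segment
    (hφ.continuousOn.mono fun _ hu => hs.trans hu.1)
    (fun _ hu => hφ.hasDerivWithinAt_Ici (hs.trans hu.1)) hC t ⟨hst, le_rfl⟩

/-- The local error of one Euler step. It is quadratic in the step, so the accumulated error is
controlled by the sum of the squared step sizes. -/
theorem IsForwardSolution.norm_sub_sub_le {d : ℕ} {h : Space d → Space d} {L : ℝ≥0}
    (hL : LipschitzWith L h) {φ : ℝ → Space d}
    (hφ : IsForwardSolution h φ) {C s t : ℝ} (hs : 0 ≤ s) (hst : s ≤ t)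
    (hC : ∀ u ∈ Set.Ico s t, ‖h (φ u)‖ ≤ C) :
    ‖φ t - φ s - (t - s) • h (φ s)‖ ≤ L * C * (t - s) ^ 2 := by
  have key := norm_image_sub_le_of_norm_deriv_right_le_segment
    (f := fun u => φ u - (u - s) • h (φ s)) (f' := fun u => h (φ u) - h (φ s))
    (a := s) (b := t) (C := L * (C * (t - s)))
    ((hφ.continuousOn.mono fun _ hu => hs.trans hu.1).sub (by fun_prop))
    (fun u hu => ?_) ?_ t ⟨hst, le_rfl⟩
  · simp only [sub_self, zero_smul, sub_zero] at key
    rw [show φ t - φ s - (t - s) • h (φ s) = φ t - (t - s) • h (φ s) - φ s by abel]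
    exact key.trans_eq (by ring)
  · refine (hφ.hasDerivWithinAt_Ici (hs.trans hu.1)).sub ?_
    simpa using (((hasDerivAt_id u).sub_const s).smul_const (h (φ s))).hasDerivWithinAt
  · intro u hu
    rw [← dist_eq_norm]
    refine (hL.dist_le_mul _ _).trans ?_
    rw [dist_eq_norm]
    have hC0 : 0 ≤ C := (norm_nonneg _).trans (hC u hu)
    have := hφ.norm_sub_le hs hu.1 (C := C) fun v hv => hC v ⟨hv.1, hv.2.trans hu.2⟩
    gcongr
    exact this.trans (by gcongr; exact hu.2.le)

/-- The solution of `x' = h(x)` on `[0, ∞)` with initial value `x`. -/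
noncomputable def flow {d : ℕ} {h : Space d → Space d} {L : ℝ≥0} (hL : LipschitzWith L h)
    (x : Space d) : ℝ → Space d :=
  (exists_forwardSolution hL x).choose

theorem flow_zero {d : ℕ} {h : Space d → Space d} {L : ℝ≥0} (hL : LipschitzWith L h)
    (x : Space d) : flow hL x 0 = x :=
  (exists_forwardSolution hL x).choose_spec.1

theorem flow_isForwardSolution {d : ℕ} {h : Space d → Space d} {L : ℝ≥0}
    (hL : LipschitzWith L h) (x : Space d) : IsForwardSolution h (flow hL x) :=
  (exists_forwardSolution hL x).choose_spec.2

theorem flow_add {d : ℕ} {h : Space d → Space d} {L : ℝ≥0} (hL : LipschitzWith L h)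
    (x : Space d) {s t : ℝ} (hs : 0 ≤ s) (ht : 0 ≤ t) :
    flow hL x (s + t) = flow hL (flow hL x s) t := by
  have := ((flow_isForwardSolution hL x).shift hs).dist_le hL
    (flow_isForwardSolution hL (flow hL x s)) ht
  simpa [flow_zero] using this

theorem continuous_flow {d : ℕ} {h : Space d → Space d} {L : ℝ≥0} (hL : LipschitzWith L h)
    {t : ℝ} (ht : 0 ≤ t) : Continuous fun x => flow hL x t := by
  refine (LipschitzWith.of_dist_le_mul (K := ⟨Real.exp (L * t), (Real.exp_pos _).le⟩)
    fun x y => ?_).continuous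
  have := (flow_isForwardSolution hL x).dist_le hL (flow_isForwardSolution hL y) ht
  rw [flow_zero, flow_zero, mul_comm] at this
  exact this

end Flow

/-! ### Block times and interpolation -/

section Time

variable {a : ℕ → ℝ}

theorem time_succ (a : ℕ → ℝ) (n : ℕ) : time a (n + 1) = time a n + a n :=
  Finset.sum_range_succ _ _

theorem IsStepSize.time_strictMono (ha : IsStepSize a) : StrictMono (time a) :=
  strictMono_nat_of_lt_succ fun n => by rw [time_succ]; linarith [ha.pos n]

theorem IsStepSize.tendsto_time (ha : IsStepSize a) : Tendsto (time a) atTop atTop :=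
  (not_summable_iff_tendsto_nat_atTop_of_nonneg fun n => (ha.pos n).le).1 ha.not_summable

theorem IsStepSize.tendsto_zero (ha : IsStepSize a) : Tendsto a atTop (𝓝 0) := by
  have := ha.summable_sq.tendsto_atTop_zero.sqrt
  simpa [Real.sqrt_sq (ha.pos _).le] using this

theorem IsStepSize.time_add_le_nextIndex (ha : IsStepSize a) (T : ℝ) (n : ℕ) :
    time a n + T ≤ time a (nextIndex a T n) :=
  Nat.sInf_mem (ha.tendsto_time.eventually_ge_atTop (time a n + T)).exists

theorem IsStepSize.lt_nextIndex (ha : IsStepSize a) {T : ℝ} (hT : 0 < T) (n : ℕ) :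
    n < nextIndex a T n :=
  ha.time_strictMono.lt_iff_lt.1 (by linarith [ha.time_add_le_nextIndex T n])

theorem time_lt_of_lt_nextIndex {T : ℝ} {n k : ℕ} (hk : k < nextIndex a T n) :
    time a k < time a n + T :=
  not_le.1 fun hle => absurd (Nat.sInf_le (s := {m | time a n + T ≤ time a m}) hle) (not_le.2 hk)

/-- A block overshoots its nominal length `T` by at most its last step. -/
theorem IsStepSize.time_nextIndex_le (ha : IsStepSize a) {T : ℝ} (hT : 0 < T) {n : ℕ} {α : ℝ}
    (hα : ∀ k, n ≤ k → a k ≤ α) : time a (nextIndex a T n) ≤ time a n + T + α := by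
  have h1 := ha.lt_nextIndex hT n
  obtain ⟨k, hk⟩ : ∃ k, nextIndex a T n = k + 1 := ⟨nextIndex a T n - 1, by omega⟩
  rw [hk, time_succ]
  linarith [time_lt_of_lt_nextIndex (a := a) (T := T) (n := n) (k := k) (by omega),
    hα k (by omega)]

theorem IsStepSize.exists_mem_Ico_time (ha : IsStepSize a) {n m : ℕ} {s : ℝ}
    (hs : s ∈ Set.Ico (time a n) (time a m)) :
    ∃ k, n ≤ k ∧ k < m ∧ s ∈ Set.Ico (time a k) (time a (k + 1)) := by
  induction m with
  | zero => exact absurd (hs.1.trans_lt hs.2) (not_lt.2 (ha.time_strictMono.monotone n.zero_le))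
  | succ m ih =>
    by_cases hsm : s < time a m
    · obtain ⟨k, h1, h2, h3⟩ := ih ⟨hs.1, hsm⟩
      exact ⟨k, h1, by omega, h3⟩
    · have : n < m + 1 := ha.time_strictMono.lt_iff_lt.1 (hs.1.trans_lt hs.2)
      exact ⟨m, by omega, by omega, not_lt.1 hsm, hs.2⟩

theorem IsStepSize.interpolate_eq (ha : IsStepSize a) {d : ℕ} (y : ℕ → Space d) {k : ℕ} {s : ℝ}
    (hs : s ∈ Set.Ico (time a k) (time a (k + 1))) :
    interpolate a y s = y k + ((s - time a k) / a k) • (y (k + 1) - y k) := by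
  have : sInf {k : ℕ | s < time a (k + 1)} = k := by
    refine le_antisymm (Nat.sInf_le hs.2) (le_csInf ⟨k, hs.2⟩ fun j hj => ?_)
    have : k < j + 1 := ha.time_strictMono.lt_iff_lt.1 (hs.1.trans_lt hj)
    omega
  simp only [interpolate, this]

theorem IsStepSize.fraction_mem (ha : IsStepSize a) {k : ℕ} {s : ℝ}
    (hs : s ∈ Set.Ico (time a k) (time a (k + 1))) :
    0 ≤ (s - time a k) / a k ∧ (s - time a k) / a k ≤ 1 := by
  have h1 := hs.1
  have h2 := hs.2
  rw [time_succ] at h2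
  exact ⟨div_nonneg (by linarith) (ha.pos k).le, (div_le_one (ha.pos k)).2 (by linarith)⟩

end Time

/-! ### Tracking the flow over a block -/

section Tracking

variable {d : ℕ} {h : Space d → Space d} {L : ℝ≥0} {a : ℕ → ℝ}

/-- Discrete Gronwall. The deviation telescopes into a partial sum of the noise, the Euler errors,
and a Lipschitz feedback term. The noise enters only through partial sums, so its cancellations are
retained. -/
theorem norm_sub_flow_le_of_recursion (hL : LipschitzWith L h) (ha : IsStepSize a)
    {y w : ℕ → Space d} {n m : ℕ} {ε β S C : ℝ}
    (hy : ∀ k, n ≤ k → k < m → y (k + 1) = y k + a k • h (y k) + w k)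
    (hw : ∀ k, n ≤ k → k ≤ m → ‖∑ j ∈ Finset.Ico n k, w j‖ ≤ ε)
    (hβ : ∀ k, ∑ j ∈ Finset.Ico n k, a j ^ 2 ≤ β) (hS : time a m ≤ time a n + S)
    (hC0 : 0 ≤ C) (hC : ∀ u ∈ Set.Icc 0 S, ‖h (flow hL (y n) u)‖ ≤ C) {k : ℕ} (hnk : n ≤ k)
    (hkm : k ≤ m) :
    ‖y k - flow hL (y n) (time a k - time a n)‖ ≤ (ε + L * C * β) * Real.exp (L * S) := by
  set z : ℕ → Space d := fun k => flow hL (y n) (time a k - time a n) with hz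
  have hmono := ha.time_strictMono.monotone
  set e : ℕ → Space d := fun k => z (k + 1) - z k - a k • h (z k) with he
  have hε : 0 ≤ ε := (norm_nonneg _).trans (hw n le_rfl (hnk.trans hkm))
  have hβ0 : 0 ≤ β := by simpa using hβ n
  have hebd : ∀ k, n ≤ k → k < m → ‖e k‖ ≤ L * C * a k ^ 2 := by
    intro k hk hkm
    have h1 := hmono hk
    have h2 := hmono (show k + 1 ≤ m from hkm)
    have := (flow_isForwardSolution hL (y n)).norm_sub_sub_le hL (C := C)
      (s := time a k - time a n) (t := time a (k + 1) - time a n) (by linarith)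
      (by linarith [hmono k.le_succ]) (fun u hu => hC u ⟨by linarith [hu.1], by linarith [hu.2]⟩)
    rw [time_succ, show time a k + a k - time a n - (time a k - time a n) = a k by ring,
      ← time_succ] at this
    exact this
  have htel : ∀ k, n ≤ k → k ≤ m → y k - z k = ∑ j ∈ Finset.Ico n k, w j
      - ∑ j ∈ Finset.Ico n k, e j + ∑ j ∈ Finset.Ico n k, a j • (h (y j) - h (z j)) := by
    intro k hk
    induction k, hk using Nat.le_induction with
    | base => intro _; simp [hz, flow_zero]
    | succ k hk ih =>
      intro hkm
      rw [Finset.sum_Ico_succ_top hk, Finset.sum_Ico_succ_top hk, Finset.sum_Ico_succ_top hk,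
        hy k hk hkm]
      have h3 : z (k + 1) = z k + a k • h (z k) + e k := by simp only [he]; abel
      have h4 := ih (by omega)
      rw [h3, smul_sub]
      rw [show y k + a k • h (y k) + w k - (z k + a k • h (z k) + e k)
        = (y k - z k) + (a k • h (y k) - a k • h (z k)) + w k - e k by abel, h4]
      abel
  -- `U` dominates the deviation and satisfies `U (k + 1) ≤ (1 + L * a k) * U k`.
  set U : ℕ → ℝ := fun k => (ε + L * C * β) + ∑ j ∈ Finset.Ico n k, L * a j * ‖y j - z j‖ with hU
  have hDU : ∀ k, n ≤ k → k ≤ m → ‖y k - z k‖ ≤ U k := by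
    intro k hk hkm
    rw [htel k hk hkm]
    have h1 : ‖∑ j ∈ Finset.Ico n k, e j‖ ≤ L * C * β := by
      calc _ ≤ ∑ j ∈ Finset.Ico n k, L * C * a j ^ 2 :=
            norm_sum_le_of_le _ fun j hj => by
              rw [Finset.mem_Ico] at hj
              exact hebd j hj.1 (by omega)
        _ = L * C * ∑ j ∈ Finset.Ico n k, a j ^ 2 := by rw [Finset.mul_sum]
        _ ≤ _ := by gcongr; exact hβ k
    have h2 : ‖∑ j ∈ Finset.Ico n k, a j • (h (y j) - h (z j))‖
        ≤ ∑ j ∈ Finset.Ico n k, L * a j * ‖y j - z j‖ := by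
      refine norm_sum_le_of_le _ fun j _ => ?_
      rw [norm_smul, Real.norm_of_nonneg (ha.pos j).le]
      have := hL.dist_le_mul (y j) (z j)
      rw [dist_eq_norm, dist_eq_norm] at this
      calc a j * ‖h (y j) - h (z j)‖ ≤ a j * (L * ‖y j - z j‖) := by
            gcongr; exact (ha.pos j).le
        _ = _ := by ring
    calc _ ≤ _ := norm_add_le _ _
      _ ≤ ‖∑ j ∈ Finset.Ico n k, w j‖ + ‖∑ j ∈ Finset.Ico n k, e j‖ + _ := by
          gcongr; exact norm_sub_le _ _
      _ ≤ ε + L * C * β + _ := by gcongr; exact hw k hk hkm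
  have hUexp : ∀ k, n ≤ k → k ≤ m →
      U k ≤ (ε + L * C * β) * Real.exp (L * (time a k - time a n)) := by
    intro k hk
    induction k, hk using Nat.le_induction with
    | base => intro _; simp [hU]
    | succ k hk ih =>
      intro hkm
      have h1 : U (k + 1) = U k + L * a k * ‖y k - z k‖ := by
        simp only [hU]; rw [Finset.sum_Ico_succ_top hk]; ring
      have h2 := hDU k hk (by omega)
      have h3 : 0 ≤ U k := (norm_nonneg _).trans h2
      calc U (k + 1) ≤ U k + L * a k * U k := by
            rw [h1]; gcongr; exact mul_nonneg L.2 (ha.pos k).le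
        _ = U k * (L * a k + 1) := by ring
        _ ≤ U k * Real.exp (L * a k) := by gcongr; exact Real.add_one_le_exp _
        _ ≤ ((ε + L * C * β) * Real.exp (L * (time a k - time a n))) * Real.exp (L * a k) := by
            gcongr; exact ih (by omega)
        _ = _ := by rw [mul_assoc, ← Real.exp_add, time_succ]; ring_nf
  refine ((hDU k hnk hkm).trans (hUexp k hnk hkm)).trans ?_
  gcongr
  linarith [hmono hkm]

/-- The recursion is only required at those indices where the iterate is in the ball of radius `R`;
the conclusion shows that the iterates do not leave this ball. -/
theorem norm_sub_flow_le (hL : LipschitzWith L h) (ha : IsStepSize a)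
    {y w : ℕ → Space d} {n m : ℕ} {ε β S C R₀ R : ℝ}
    (hy : ∀ k, n ≤ k → k < m → ‖y k‖ ≤ R → y (k + 1) = y k + a k • h (y k) + w k)
    (hw : ∀ k, n ≤ k → k ≤ m → ‖∑ j ∈ Finset.Ico n k, w j‖ ≤ ε)
    (hβ : ∀ k, ∑ j ∈ Finset.Ico n k, a j ^ 2 ≤ β) (hS : time a m ≤ time a n + S)
    (hC0 : 0 ≤ C) (hC : ∀ u ∈ Set.Icc 0 S, ‖h (flow hL (y n) u)‖ ≤ C)
    (hR₀ : ∀ u ∈ Set.Icc 0 S, ‖flow hL (y n) u‖ ≤ R₀)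
    (hR : R₀ + (ε + L * C * β) * Real.exp (L * S) ≤ R) {k : ℕ} (hnk : n ≤ k) (hkm : k ≤ m) :
    ‖y k - flow hL (y n) (time a k - time a n)‖ ≤ (ε + L * C * β) * Real.exp (L * S) := by
  have hmono := ha.time_strictMono.monotone
  induction k using Nat.strong_induction_on with
  | _ k ih =>
    -- Bootstrap: the estimate at all `j < k` puts `y j` in the ball, where the recursion is
    -- available, and this yields the estimate at `k`.
    refine norm_sub_flow_le_of_recursion hL ha (m := k) (fun j hj hjk => ?_)
      (fun j hj hjk => hw j hj (hjk.trans hkm)) hβ ((hmono hkm).trans hS) hC0 hC hnk le_rfl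
    refine hy j hj (by omega) ?_
    have h1 := ih j hjk hj (by omega)
    have h2 := hR₀ (time a j - time a n)
      ⟨by linarith [hmono hj], by linarith [hmono (show j ≤ m by omega)]⟩
    linarith [norm_le_norm_add_norm_sub' (y j) (flow hL (y n) (time a j - time a n))]

/-- Within one step the flow moves by at most `C * α`, so both endpoints of the segment are within
`η + C * α` of the flow at time `s`, and balls are convex. -/
theorem norm_interpolate_sub_flow_le (hL : LipschitzWith L h) (ha : IsStepSize a)
    {y : ℕ → Space d} {n m : ℕ} {η α S C : ℝ}
    (hη : ∀ k, n ≤ k → k ≤ m → ‖y k - flow hL (y n) (time a k - time a n)‖ ≤ η)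
    (hα : ∀ k, n ≤ k → a k ≤ α) (hS : time a m ≤ time a n + S)
    (hC0 : 0 ≤ C) (hC : ∀ u ∈ Set.Icc 0 S, ‖h (flow hL (y n) u)‖ ≤ C) {s : ℝ}
    (hs : s ∈ Set.Ico (time a n) (time a m)) :
    ‖interpolate a y s - flow hL (y n) (s - time a n)‖ ≤ η + C * α := by
  have hmono := ha.time_strictMono.monotone
  obtain ⟨k, hnk, hkm, hsk⟩ := ha.exists_mem_Ico_time hs
  rw [ha.interpolate_eq y hsk]
  obtain ⟨hθ0, hθ1⟩ := ha.fraction_mem hsk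
  set θ := (s - time a k) / a k
  set p := flow hL (y n) (s - time a n)
  have hk1 := hmono (show k + 1 ≤ m from hkm)
  have hnk' := hmono hnk
  have hts := time_succ a k
  have hak := hα k hnk
  have h1 : ‖y k - p‖ ≤ η + C * α := by
    have h2 := (flow_isForwardSolution hL (y n)).norm_sub_le (C := C)
      (s := time a k - time a n) (t := s - time a n) (by linarith) (by linarith [hsk.1])
      (fun u hu => hC u ⟨by linarith [hu.1], by linarith [hu.2, hsk.2]⟩)
    rw [norm_sub_rev] at h2
    have h3 : C * (s - time a n - (time a k - time a n)) ≤ C * α := by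
      gcongr; linarith [hsk.2]
    linarith [norm_sub_le_norm_sub_add_norm_sub (y k) (flow hL (y n) (time a k - time a n)) p,
      hη k hnk hkm.le]
  have h2 : ‖y (k + 1) - p‖ ≤ η + C * α := by
    have h2 := (flow_isForwardSolution hL (y n)).norm_sub_le (C := C)
      (s := s - time a n) (t := time a (k + 1) - time a n) (by linarith [hs.1])
      (by linarith [hsk.2])
      (fun u hu => hC u ⟨by linarith [hu.1, hs.1], by linarith [hu.2, hsk.2]⟩)
    have h3 : C * (time a (k + 1) - time a n - (s - time a n)) ≤ C * α := by
      gcongr; linarith [hsk.1]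
    linarith [norm_sub_le_norm_sub_add_norm_sub (y (k + 1))
      (flow hL (y n) (time a (k + 1) - time a n)) p, hη (k + 1) (by omega) hkm]
  rw [show y k + θ • (y (k + 1) - y k) - p = (1 - θ) • (y k - p) + θ • (y (k + 1) - p) by
    module]
  calc _ ≤ ‖(1 - θ) • (y k - p)‖ + ‖θ • (y (k + 1) - p)‖ := norm_add_le _ _
    _ = (1 - θ) * ‖y k - p‖ + θ * ‖y (k + 1) - p‖ := by
        rw [norm_smul, norm_smul, Real.norm_of_nonneg hθ0, Real.norm_of_nonneg (by linarith)]
    _ ≤ (1 - θ) * (η + C * α) + θ * (η + C * α) := by gcongr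
    _ = _ := by ring

theorem solvesOnBlock_flow (hL : LipschitzWith L h) (T : ℝ) (n : ℕ) (p : Space d) :
    SolvesOnBlock h a T n p fun s => flow hL p (s - time a n) := by
  refine ⟨by simp [flow_zero], fun s hs => ?_⟩
  have h1 : HasDerivWithinAt (fun u : ℝ => u - time a n) 1
      (Set.Ico (time a n) (time a (nextIndex a T n))) s :=
    ((hasDerivAt_id s).sub_const _).hasDerivWithinAt
  have := (flow_isForwardSolution hL p (s - time a n) (by linarith [hs.1])).scomp s h1
    (fun u hu => show 0 ≤ u - time a n by linarith [hu.1])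
  rw [one_smul] at this
  exact this

theorem blockDeviation_flow_le (hL : LipschitzWith L h) (ha : IsStepSize a) {T : ℝ} (hT : 0 < T)
    {y : ℕ → Space d} {n : ℕ} {η α S C : ℝ}
    (hη : ∀ k, n ≤ k → k ≤ nextIndex a T n →
      ‖y k - flow hL (y n) (time a k - time a n)‖ ≤ η)
    (hα : ∀ k, n ≤ k → a k ≤ α) (hS : time a (nextIndex a T n) ≤ time a n + S)
    (hC0 : 0 ≤ C) (hC : ∀ u ∈ Set.Icc 0 S, ‖h (flow hL (y n) u)‖ ≤ C) :
    blockDeviation a T y n (fun s => flow hL (y n) (s - time a n)) ≤ η + C * α := by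
  refine csSup_le ?_ ?_
  · exact (Set.nonempty_Ico.2 (ha.time_strictMono (ha.lt_nextIndex hT n))).image _
  · rintro _ ⟨s, hs, rfl⟩
    exact norm_interpolate_sub_flow_le hL ha hη hα hS hC0 hC hs

theorem SolvesOnBlock.eq_flow (hL : LipschitzWith L h) {T : ℝ} {n : ℕ} {p : Space d}
    {φ : ℝ → Space d} (hφ : SolvesOnBlock h a T n p φ) {s : ℝ}
    (hs : s ∈ Set.Ico (time a n) (time a (nextIndex a T n))) :
    φ s = flow hL p (s - time a n) := by
  have key : ∀ ψ, SolvesOnBlock h a T n p ψ →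
      ContinuousOn ψ (Set.Icc (time a n) s) ∧
      ∀ t ∈ Set.Ico (time a n) s, HasDerivWithinAt ψ (h (ψ t)) (Set.Ici t) t := by
    intro ψ hψ
    refine ⟨fun t ht => ((hψ.2 t ⟨ht.1, ht.2.trans_lt hs.2⟩).continuousWithinAt).mono
      fun u hu => ⟨hu.1, hu.2.trans_lt hs.2⟩, fun t ht => ?_⟩
    refine (hψ.2 t ⟨ht.1, ht.2.trans hs.2⟩).mono_of_mem_nhdsWithin ?_
    exact mem_of_superset (Ico_mem_nhdsGE (ht.2.trans hs.2)) (Set.Ico_subset_Ico ht.1 le_rfl)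
  have h2 := solvesOnBlock_flow (a := a) hL T n p
  exact ODE_solution_unique (v := fun _ => h) (K := L) (fun _ => hL) (key φ hφ).1 (key φ hφ).2
    (key _ h2).1 (key _ h2).2 (hφ.1.trans h2.1.symm) ⟨hs.1, le_rfl⟩

/-- The supremum runs over a half-open block; its right endpoint is reached as a left limit of the
interpolated path. -/
theorem norm_sub_flow_le_blockDeviation (hL : LipschitzWith L h) (ha : IsStepSize a) {T : ℝ}
    (hT : 0 < T) {y : ℕ → Space d} {n : ℕ} {φ : ℝ → Space d}
    (hφ : SolvesOnBlock h a T n (y n) φ) :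
    ‖y (nextIndex a T n) - flow hL (y n) (time a (nextIndex a T n) - time a n)‖
      ≤ blockDeviation a T y n φ := by
  have hmono := ha.time_strictMono.monotone
  have hlt := ha.lt_nextIndex hT n
  set m := nextIndex a T n with hm
  -- Needed because `sSup` of an unbounded set has the default value `0`.
  have hbdd : BddAbove ((fun s => ‖interpolate a y s - φ s‖) ''
      Set.Ico (time a n) (time a m)) := by
    refine ⟨2 * ∑ j ∈ Finset.range (m + 1), ‖y j‖
      + gronwallBound ‖y n‖ L ‖h 0‖ (time a m - time a n), ?_⟩
    rintro _ ⟨s, hs, rfl⟩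
    obtain ⟨k, hnk, hkm, hsk⟩ := ha.exists_mem_Ico_time hs
    have h1 : ‖φ s‖ ≤ gronwallBound ‖y n‖ L ‖h 0‖ (time a m - time a n) := by
      rw [hφ.eq_flow hL hs]
      exact (flow_isForwardSolution hL (y n)).norm_le hL (by rw [flow_zero])
        (by linarith [hs.1]) (by linarith [hs.2])
    have h2 : ∀ j ≤ m, ‖y j‖ ≤ ∑ j ∈ Finset.range (m + 1), ‖y j‖ := fun j hj =>
      Finset.single_le_sum (f := fun j => ‖y j‖) (fun _ _ => norm_nonneg _)
        (Finset.mem_range.2 (by omega))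
    have h3 : ‖interpolate a y s‖ ≤ 2 * ∑ j ∈ Finset.range (m + 1), ‖y j‖ := by
      rw [ha.interpolate_eq y hsk]
      obtain ⟨hθ0, hθ1⟩ := ha.fraction_mem hsk
      set θ := (s - time a k) / a k
      rw [show y k + θ • (y (k + 1) - y k) = (1 - θ) • y k + θ • y (k + 1) by module]
      calc _ ≤ ‖(1 - θ) • y k‖ + ‖θ • y (k + 1)‖ := norm_add_le _ _
        _ = (1 - θ) * ‖y k‖ + θ * ‖y (k + 1)‖ := by
          rw [norm_smul, norm_smul, Real.norm_of_nonneg hθ0, Real.norm_of_nonneg (by linarith)]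
        _ ≤ 1 * ‖y k‖ + 1 * ‖y (k + 1)‖ := by gcongr; linarith
        _ ≤ _ := by linarith [h2 k hkm.le, h2 (k + 1) hkm]
    exact (norm_sub_le _ _).trans (add_le_add h3 h1)
  obtain ⟨k, hk⟩ : ∃ k, m = k + 1 := ⟨m - 1, by omega⟩
  have hkk : time a k < time a m := ha.time_strictMono (by omega)
  have hev : ∀ᶠ s in 𝓝[<] (time a m), ‖y k + ((s - time a k) / a k) • (y m - y k)
      - flow hL (y n) (s - time a n)‖ ≤ blockDeviation a T y n φ := by
    filter_upwards [Ico_mem_nhdsLT hkk] with s hs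
    have hs' : s ∈ Set.Ico (time a n) (time a m) :=
      ⟨(hmono (show n ≤ k by omega)).trans hs.1, hs.2⟩
    rw [← hφ.eq_flow hL hs', hk, ← ha.interpolate_eq y (by rwa [← hk])]
    exact le_csSup hbdd ⟨s, hs', rfl⟩
  refine le_of_tendsto (Tendsto.norm (Tendsto.sub ?_ ?_)) hev
  · have h1 : Tendsto (fun s => y k + ((s - time a k) / a k) • (y m - y k)) (𝓝 (time a m))
        (𝓝 (y k + ((time a m - time a k) / a k) • (y m - y k))) :=
      Continuous.tendsto (by fun_prop) _
    rw [show (time a m - time a k) / a k = 1 by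
      rw [hk, time_succ, add_sub_cancel_left, div_self (ha.pos k).ne']] at h1
    simpa using h1.mono_left nhdsWithin_le_nhds
  · have h1 := (flow_isForwardSolution hL (y n)).continuousOn (time a m - time a n)
      (by simpa using hmono hlt.le)
    refine Tendsto.comp h1 (tendsto_nhdsWithin_iff.2 ⟨?_, ?_⟩)
    · exact ((continuous_sub_right (time a n)).tendsto _).mono_left nhdsWithin_le_nhds
    · filter_upwards [Ico_mem_nhdsLT hkk] with s hs
      have := hmono (show n ≤ k by omega)
      exact sub_nonneg.2 (this.trans hs.1)

end Tracking

/-! ### Liapunov descent along the flow and along tracking sequences -/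

section Liapunov

variable {d : ℕ} {h : Space d → Space d} {G : Set (Space d)} {V : Space d → ℝ}

theorem IsLiapunov.continuousAt (hV : IsLiapunov h G V) {p : Space d} (hp : p ∈ G) :
    ContinuousAt V p :=
  (hV.differentiableOn.differentiableAt (hV.isOpen.mem_nhds hp)).continuousAt

theorem IsLiapunov.hasFDerivAt (hV : IsLiapunov h G V) {p : Space d} (hp : p ∈ G) :
    HasFDerivAt V (InnerProductSpace.toDual ℝ (Space d) (gradient V p)) p :=
  (hV.differentiableOn.differentiableAt (hV.isOpen.mem_nhds hp)).hasGradientAt.hasFDerivAt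

theorem IsLiapunov.hasDerivWithinAt (hV : IsLiapunov h G V) {φ : ℝ → Space d}
    (hφ : IsForwardSolution h φ) {t : ℝ} (ht : 0 ≤ t) (hG : φ t ∈ G) :
    HasDerivWithinAt (fun u => V (φ u)) (inner ℝ (gradient V (φ t)) (h (φ t))) (Set.Ici 0) t := by
  have := (hV.hasFDerivAt hG).comp_hasDerivWithinAt t (hφ t ht)
  rwa [InnerProductSpace.toDual_apply_apply] at this

theorem IsLiapunov.antitoneOn (hV : IsLiapunov h G V) {φ : ℝ → Space d}
    (hφ : IsForwardSolution h φ) {s t : ℝ} (hs : 0 ≤ s) (hG : ∀ u ∈ Set.Icc s t, φ u ∈ G) :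
    AntitoneOn (fun u => V (φ u)) (Set.Icc s t) := by
  have hd : ∀ u ∈ interior (Set.Icc s t),
      HasDerivAt (fun u => V (φ u)) (inner ℝ (gradient V (φ u)) (h (φ u))) u := fun u hu => by
    rw [interior_Icc] at hu
    exact (hV.hasDerivWithinAt hφ (hs.trans hu.1.le) (hG u (Set.Ioo_subset_Icc_self hu))).hasDerivAt
      (Ici_mem_nhds (hs.trans_lt hu.1))
  refine antitoneOn_of_deriv_nonpos (convex_Icc s t) (fun u hu => ?_)
    (fun u hu => (hd u hu).differentiableAt.differentiableWithinAt) fun u hu => ?_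
  · exact ((hV.hasDerivWithinAt hφ (hs.trans hu.1) (hG u hu)).continuousWithinAt).mono
      fun v hv => hs.trans hv.1
  · rw [(hd u hu).deriv]
    exact hV.decreasing _ (hG u (interior_subset hu))

/-- Continuous induction in time: the set of good times is closed because the sublevel set is
compact, and extends to the right because `G` is open and `V` is antitone as long as the path is in
`G`. -/
theorem IsLiapunov.mem_sublevel (hV : IsLiapunov h G V) {φ : ℝ → Space d}
    (hφ : IsForwardSolution h φ) {r : ℝ} (h0 : φ 0 ∈ {p ∈ G | V p ≤ r}) {t : ℝ} (ht : 0 ≤ t) :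
    φ t ∈ {p ∈ G | V p ≤ r} := by
  refine IsClosed.Icc_subset_of_forall_mem_nhdsWithin (s := {u | φ u ∈ {p ∈ G | V p ≤ r}})
    (a := 0) (b := t) ?_ h0 ?_ ⟨ht, le_rfl⟩
  · rw [Set.inter_comm]
    exact (hφ.continuousOn.mono Set.Icc_subset_Ici_self).preimage_isClosed_of_isClosed
      isClosed_Icc (hV.proper r).isClosed
  · rintro u ⟨hu, hu0, -⟩
    have hcont : ContinuousWithinAt φ (Set.Ici u) u := (hφ.continuousOn u hu0).mono
      (Set.Ici_subset_Ici.2 hu0)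
    have hnhds := hcont (hV.isOpen.mem_nhds hu.1)
    obtain ⟨v, huv, hv⟩ := (mem_nhdsGE_iff_exists_Icc_subset).1 hnhds
    have hanti := hV.antitoneOn hφ hu0 (t := v) fun w hw => hv hw
    refine mem_of_superset (Ioc_mem_nhdsGT huv) fun w hw => ?_
    have hw' : w ∈ Set.Icc u v := Set.Ioc_subset_Icc_self hw
    exact ⟨hv hw', (hanti ⟨le_rfl, huv.le⟩ hw' hw.1.le).trans hu.2⟩

theorem IsLiapunov.continuousOn_sublevel (hV : IsLiapunov h G V) (r : ℝ) :
    ContinuousOn V {p ∈ G | V p ≤ r} :=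
  fun _ hp => (hV.continuousAt hp.1).continuousWithinAt

theorem IsLiapunov.isCompact_Icc (hV : IsLiapunov h G V) (s r : ℝ) :
    IsCompact {p ∈ G | s ≤ V p ∧ V p ≤ r} := by
  have h1 := (hV.continuousOn_sublevel r).preimage_isClosed_of_isClosed (hV.proper r).isClosed
    (isClosed_Ici (a := s))
  have h2 : {p ∈ G | V p ≤ r} ∩ V ⁻¹' Set.Ici s = {p ∈ G | s ≤ V p ∧ V p ≤ r} :=
    Set.ext fun p => ⟨fun hp => ⟨hp.1.1, hp.2, hp.1.2⟩, fun hp => ⟨⟨hp.1, hp.2.2⟩, hp.2.1⟩⟩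
  exact (hV.proper r).of_isClosed_subset (h2 ▸ h1) fun p hp => ⟨hp.1, hp.2.2⟩

/-- A neighbourhood of the zero set of a Liapunov function contains a sublevel set. -/
theorem IsLiapunov.exists_sublevel_subset (hV : IsLiapunov h G V) {U : Set (Space d)}
    (hU : IsOpen U) (hHU : stationarySet h G V ⊆ U) :
    ∃ s > 0, {p ∈ G | V p ≤ s} ⊆ U := by
  rw [hV.stationary_eq] at hHU
  have hK : IsCompact ({p ∈ G | V p ≤ 1} \ U) := (hV.proper 1).diff hU
  rcases (({p ∈ G | V p ≤ 1} \ U)).eq_empty_or_nonempty with he | hne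
  · exact ⟨1, one_pos, Set.sdiff_eq_empty.1 he⟩
  · obtain ⟨q, hq, hmin⟩ := hK.exists_isMinOn hne
      ((hV.continuousOn_sublevel 1).mono Set.sdiff_subset)
    have hq0 : 0 < V q := lt_of_le_of_ne (hV.nonneg q hq.1.1) fun h0 => hq.2 (hHU ⟨hq.1.1, h0.symm⟩)
    refine ⟨min 1 (V q / 2), by positivity, fun p hp => by_contra fun hpU => ?_⟩
    have h1 : V q ≤ V p := hmin ⟨⟨hp.1, hp.2.trans (min_le_left _ _)⟩, hpU⟩
    linarith [hp.2.trans (min_le_right _ _)]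

/-- Points near a compact sublevel set are in `G`, with nearby values of `V`. -/
theorem IsLiapunov.exists_uniform (hV : IsLiapunov h G V) (r : ℝ) {κ : ℝ} (hκ : 0 < κ) :
    ∃ η > 0, ∀ p ∈ {p ∈ G | V p ≤ r}, ∀ q, ‖q - p‖ ≤ η → q ∈ G ∧ V q ≤ V p + κ := by
  obtain ⟨η₁, hη₁, hsub⟩ := (hV.proper r).exists_cthickening_subset_open hV.isOpen
    fun p hp => hp.1
  have := (hV.proper r).uniformContinuousAt_of_continuousAt V
    (fun p hp => hV.continuousAt hp.1) (Metric.dist_mem_uniformity hκ)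
  obtain ⟨η₂, hη₂, hunif⟩ := Metric.mem_uniformity_dist.1 this
  refine ⟨min η₁ (η₂ / 2), by positivity, fun p hp q hq => ⟨hsub ?_, ?_⟩⟩
  · refine Metric.mem_cthickening_of_dist_le q p η₁ _ hp ?_
    rw [dist_eq_norm]
    exact hq.trans (min_le_left _ _)
  · have h1 : dist p q < η₂ := by
      rw [dist_comm, dist_eq_norm]
      linarith [hq.trans (min_le_right _ _)]
    have h2 : dist (V p) (V q) < κ := hunif h1 hp
    rw [Real.dist_eq, abs_lt] at h2
    linarith [h2.1]

variable {L : ℝ≥0}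

theorem IsLiapunov.flow_mem (hV : IsLiapunov h G V) (hL : LipschitzWith L h) {p : Space d} {r : ℝ}
    (hp : p ∈ {p ∈ G | V p ≤ r}) {t : ℝ} (ht : 0 ≤ t) : flow hL p t ∈ {p ∈ G | V p ≤ r} :=
  hV.mem_sublevel (flow_isForwardSolution hL p) (by rwa [flow_zero]) ht

theorem IsLiapunov.flow_le (hV : IsLiapunov h G V) (hL : LipschitzWith L h) {p : Space d}
    (hp : p ∈ G) {s t : ℝ} (hs : 0 ≤ s) (hst : s ≤ t) : V (flow hL p t) ≤ V (flow hL p s) := by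
  have h1 := hV.flow_mem hL (p := flow hL p s) (r := V (flow hL p s))
    ⟨(hV.flow_mem hL (p := p) ⟨hp, le_rfl⟩ hs).1, le_rfl⟩ (sub_nonneg.2 hst)
  rw [← flow_add hL p hs (sub_nonneg.2 hst), add_sub_cancel] at h1
  exact h1.2

/-- Equality would make `V` constant along the path on `[0, t]`. Its right derivative at `0` would
then vanish, so `p` would be stationary. -/
theorem IsLiapunov.flow_lt (hV : IsLiapunov h G V) (hL : LipschitzWith L h) {p : Space d}
    (hp : p ∈ G) (hp0 : V p ≠ 0) {t : ℝ} (ht : 0 < t) : V (flow hL p t) < V p := by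
  refine lt_of_le_of_ne (hV.flow_mem hL ⟨hp, le_rfl⟩ ht.le).2 fun heq => ?_
  have hd := (hV.hasDerivWithinAt (flow_isForwardSolution hL p) le_rfl
    (by rwa [flow_zero])).mono (fun u hu => hu.1 : Set.Icc 0 t ⊆ Set.Ici 0)
  rw [flow_zero] at hd
  have hconst : ∀ u ∈ Set.Icc 0 t, V (flow hL p u) = V p := fun u hu =>
    le_antisymm (hV.flow_mem hL ⟨hp, le_rfl⟩ hu.1).2
      (heq ▸ hV.flow_le hL hp hu.1 hu.2)
  have hd0 : HasDerivWithinAt (fun u => V (flow hL p u)) 0 (Set.Icc 0 t) 0 :=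
    (hasDerivWithinAt_const (0 : ℝ) (Set.Icc 0 t) (V p)).congr hconst (by rw [flow_zero])
  have hinner : inner ℝ (gradient V p) (h p) = 0 :=
    (uniqueDiffOn_Icc ht 0 ⟨le_rfl, ht.le⟩).eq_deriv _ hd hd0
  have hmem : p ∈ stationarySet h G V := ⟨hp, hinner⟩
  rw [hV.stationary_eq] at hmem
  exact hp0 hmem.2

/-- The gradient need not be continuous, so compactness is applied not to `∇V · h` but to the
decrease over time `S`, which is continuous in the starting point and positive where `V ≥ s`. -/
theorem IsLiapunov.exists_uniform_decrease (hV : IsLiapunov h G V) (hL : LipschitzWith L h)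
    (r : ℝ) {s S : ℝ} (hs : 0 < s) (hS : 0 < S) :
    ∃ Δ > 0, ∀ p ∈ {p ∈ G | V p ≤ r}, s ≤ V p → V (flow hL p S) ≤ V p - Δ := by
  have hK := hV.isCompact_Icc s r
  rcases {p ∈ G | s ≤ V p ∧ V p ≤ r}.eq_empty_or_nonempty with he | hne
  · exact ⟨1, one_pos, fun p hp hsp => absurd (show p ∈ {p ∈ G | s ≤ V p ∧ V p ≤ r} from
      ⟨hp.1, hsp, hp.2⟩) (he ▸ Set.notMem_empty p)⟩
  · have hcont : ContinuousOn (fun p => V p - V (flow hL p S)) {p ∈ G | s ≤ V p ∧ V p ≤ r} :=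
      fun p hp => ((hV.continuousAt hp.1).sub
        (ContinuousAt.comp (f := fun p => flow hL p S)
          (hV.continuousAt (hV.flow_mem hL ⟨hp.1, le_rfl⟩ hS.le).1)
          (continuous_flow hL hS.le).continuousAt)).continuousWithinAt
    obtain ⟨q, hq, hmin⟩ := hK.exists_isMinOn hne hcont
    refine ⟨V q - V (flow hL q S), sub_pos.2 (hV.flow_lt hL hq.1 (by linarith [hq.2.1]) hS),
      fun p hp hsp => ?_⟩
    have : V q - V (flow hL q S) ≤ V p - V (flow hL p S) := hmin ⟨hp.1, hsp, hp.2⟩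
    linarith

theorem IsLiapunov.exists_reach_time (hV : IsLiapunov h G V) (hL : LipschitzWith L h)
    (r : ℝ) {s : ℝ} (hs : 0 < s) :
    ∃ T₀ > 0, ∀ p ∈ {p ∈ G | V p ≤ r}, ∀ t ≥ T₀, flow hL p t ∈ {p ∈ G | V p ≤ s} := by
  obtain ⟨Δ, hΔ, hdec⟩ := hV.exists_uniform_decrease hL r hs one_pos
  obtain ⟨j, hj⟩ := exists_nat_ge (r / Δ)
  rw [div_le_iff₀ hΔ] at hj
  refine ⟨j + 1, by positivity, fun p hp t ht => ?_⟩
  have key : ∀ j : ℕ, V (flow hL p j) ≤ max s (r - j * Δ) := by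
    intro j
    induction j with
    | zero => simpa [flow_zero] using Or.inr hp.2
    | succ j ih =>
      have hj0 : (0 : ℝ) ≤ j := Nat.cast_nonneg j
      have hmem := hV.flow_mem hL hp hj0
      push_cast
      rcases le_or_gt (V (flow hL p j)) s with hle | hgt
      · exact ((hV.flow_le hL hp.1 hj0 (by linarith)).trans hle).trans (le_max_left _ _)
      · have h1 : V (flow hL p j) ≤ r - j * Δ := (le_max_iff.1 ih).resolve_left (not_le.2 hgt)
        have h2 := hdec _ hmem hgt.le
        rw [← flow_add hL p hj0 zero_le_one] at h2
        exact le_max_of_le_right (by linarith)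
  have ht0 : 0 ≤ t := by linarith [Nat.cast_nonneg (α := ℝ) j]
  refine ⟨(hV.flow_mem hL hp ht0).1, ?_⟩
  refine (hV.flow_le hL hp.1 (Nat.cast_nonneg j) (by linarith)).trans ((key j).trans ?_)
  exact max_le le_rfl (by linarith)

theorem IsLiapunov.exists_sublevel_superset (hV : IsLiapunov h G V) {B : Set (Space d)}
    (hBbdd : Bornology.IsBounded B) (hBG : closure B ⊆ G) : ∃ r, B ⊆ {p ∈ G | V p ≤ r} := by
  obtain ⟨r, hr⟩ := hBbdd.isCompact_closure.bddAbove_image (f := V)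
    fun p hp => (hV.continuousAt (hBG hp)).continuousWithinAt
  exact ⟨r, fun p hp => ⟨hBG (subset_closure hp), hr ⟨p, subset_closure hp, rfl⟩⟩⟩

/-- For long blocks the trapping property holds with some `δ_B`. -/
theorem IsLiapunov.exists_traps (hV : IsLiapunov h G V) (hL : LipschitzWith L h) {a : ℕ → ℝ}
    (ha : IsStepSize a) {B : Set (Space d)} (hB : IsOpen B) (hBbdd : Bornology.IsBounded B)
    (hHB : stationarySet h G V ⊆ B) (hBG : closure B ⊆ G) :
    ∃ T₀ > 0, ∀ T ≥ T₀, ∃ δ > 0, Traps h a T B δ := by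
  obtain ⟨r, hr⟩ := hV.exists_sublevel_superset hBbdd hBG
  obtain ⟨s, hs, hsB⟩ := hV.exists_sublevel_subset hB hHB
  obtain ⟨δ, hδ, hδB⟩ := (hV.proper s).exists_cthickening_subset_open hB hsB
  obtain ⟨T₀, hT₀, hreach⟩ := hV.exists_reach_time hL r hs
  -- The flow is in `{V ≤ s}` by the end of the block, and the `δ`-thickening of that set lies in
  -- `B`.
  refine ⟨T₀, hT₀, fun T hT => ⟨δ, hδ, fun y n φ hφ hyn hdev => hδB ?_⟩⟩
  refine Metric.mem_cthickening_of_dist_le _ (flow hL (y n) (time a (nextIndex a T n) - time a n))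
    δ _ (hreach _ (hr hyn) _ ?_) ?_
  · linarith [ha.time_add_le_nextIndex T n]
  · rw [dist_eq_norm]
    exact (norm_sub_flow_le_blockDeviation hL ha (by linarith) hφ).trans hdev.le

/-- A sequence that asymptotically follows the flow and visits a sublevel set again and again
converges to the zero set of the Liapunov function. -/
theorem IsLiapunov.tendsto_infDist (hV : IsLiapunov h G V) (hL : LipschitzWith L h) {a : ℕ → ℝ}
    (ha : IsStepSize a) {y : ℕ → Space d}
    (htrack : ∀ S η : ℝ, 0 < η → ∃ N, ∀ n ≥ N, ∀ k ≥ n, time a k ≤ time a n + S →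
      ‖y k - flow hL (y n) (time a k - time a n)‖ ≤ η)
    {r : ℝ} (hvisit : ∀ N, ∃ n ≥ N, y n ∈ {p ∈ G | V p ≤ r}) :
    Tendsto (fun n => Metric.infDist (y n) (stationarySet h G V)) atTop (𝓝 0) := by
  have hmono := ha.time_strictMono.monotone
  have key : ∀ s > 0, ∃ N, ∀ k ≥ N, y k ∈ {p ∈ G | V p ≤ 3 * s} := by
    intro s hs
    set r' := max r (2 * s) with hr'
    obtain ⟨Δ, hΔ, hdec⟩ := hV.exists_uniform_decrease hL r' hs one_pos
    -- An error `Δ / 2` leaves half of the decrease per block. An error `s` takes level `s` to at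
    -- most `2 * s` at block ends, and level `2 * s` to at most `3 * s` inside a block.
    obtain ⟨η, hη, hunif⟩ := hV.exists_uniform r' (κ := min (Δ / 2) s) (by positivity)
    -- Blocks of nominal length `1` are used; late ones overshoot by at most `1`, hence the window
    -- `2`.
    obtain ⟨N₁, hN₁⟩ := htrack 2 η hη
    obtain ⟨N₂, hN₂⟩ := eventually_atTop.1
      (ha.tendsto_zero.eventually (ge_mem_nhds (zero_lt_one' ℝ)))
    have hlen : ∀ n ≥ N₂, time a (nextIndex a 1 n) ≤ time a n + 2 := fun n hn => by
      linarith [ha.time_nextIndex_le one_pos (n := n) (α := 1) fun k hk => hN₂ k (hn.trans hk)]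
    have hblock : ∀ n ≥ max N₁ N₂, y n ∈ {p ∈ G | V p ≤ r'} → ∀ k ≥ n, k ≤ nextIndex a 1 n →
        y k ∈ G ∧ V (y k) ≤ V (flow hL (y n) (time a k - time a n)) + min (Δ / 2) s := by
      intro n hn hyn k hk hkm
      refine hunif _ (hV.flow_mem hL hyn (sub_nonneg.2 (hmono hk))) _ ?_
      exact hN₁ n ((le_max_left _ _).trans hn) k hk
        ((hmono hkm).trans (hlen n ((le_max_right _ _).trans hn)))
    have hnext : ∀ n ≥ max N₁ N₂, y n ∈ {p ∈ G | V p ≤ r'} →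
        y (nextIndex a 1 n) ∈ G ∧ V (y (nextIndex a 1 n)) ≤ max (2 * s) (V (y n) - Δ / 2) := by
      intro n hn hyn
      have hlt := ha.lt_nextIndex one_pos n
      obtain ⟨h1, h2⟩ := hblock n hn hyn _ hlt.le le_rfl
      refine ⟨h1, ?_⟩
      have h3 : V (flow hL (y n) (time a (nextIndex a 1 n) - time a n)) ≤ V (flow hL (y n) 1) :=
        hV.flow_le hL hyn.1 zero_le_one (by linarith [ha.time_add_le_nextIndex 1 n])
      rcases le_or_gt s (V (y n)) with hle | hgt
      · exact le_max_of_le_right (by linarith [hdec _ hyn hle, min_le_left (Δ / 2) s])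
      · refine le_max_of_le_left ?_
        have := hV.flow_le hL hyn.1 le_rfl (zero_le_one' ℝ)
        rw [flow_zero] at this
        linarith [min_le_right (Δ / 2) s]
    obtain ⟨n₀, hn₀, hyn₀⟩ := hvisit (max N₁ N₂)
    have hreach : ∀ j : ℕ, ∃ n ≥ max N₁ N₂, y n ∈ G ∧ V (y n) ≤ max (2 * s) (r' - j * (Δ / 2)) := by
      intro j
      induction j with
      | zero =>
        refine ⟨n₀, hn₀, hyn₀.1, ?_⟩
        simp only [Nat.cast_zero, zero_mul, sub_zero]
        exact (hyn₀.2.trans (le_max_left _ _)).trans (le_max_right _ _)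
      | succ j ih =>
        obtain ⟨n, hn, hG, hle⟩ := ih
        have hle' : V (y n) ≤ r' := hle.trans (max_le (le_max_right _ _) (by
          have : (0 : ℝ) ≤ j * (Δ / 2) := by positivity
          linarith))
        obtain ⟨h1, h2⟩ := hnext n hn ⟨hG, hle'⟩
        refine ⟨_, hn.trans (ha.lt_nextIndex one_pos n).le, h1,
          h2.trans (max_le (le_max_left _ _) ?_)⟩
        rcases le_max_iff.1 hle with h3 | h3
        · exact le_max_of_le_left (by linarith)
        · exact le_max_of_le_right (by push_cast; linarith)
    obtain ⟨j, hj⟩ := exists_nat_ge (r' / (Δ / 2))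
    rw [div_le_iff₀ (by positivity)] at hj
    obtain ⟨m, hm, hmG, hmV⟩ := hreach j
    rw [max_eq_left (by linarith)] at hmV
    -- Once a block starts below `2 * s`, so do all later ones, and these blocks cover every index
    -- from `m` on.
    have hgood : ∀ k ≥ m, ∃ n ≥ max N₁ N₂, n ≤ k ∧ k < nextIndex a 1 n ∧
        y n ∈ {p ∈ G | V p ≤ 2 * s} := by
      intro k hk
      induction k, hk using Nat.le_induction with
      | base => exact ⟨m, hm, le_rfl, ha.lt_nextIndex one_pos m, hmG, hmV⟩
      | succ k hk ih =>
        obtain ⟨n, hn, hnk, hkn, hyn⟩ := ih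
        rcases lt_or_ge (k + 1) (nextIndex a 1 n) with hlt | hge
        · exact ⟨n, hn, by omega, hlt, hyn⟩
        · have heq : k + 1 = nextIndex a 1 n := by omega
          obtain ⟨h1, h2⟩ := hnext n hn ⟨hyn.1, hyn.2.trans (le_max_right _ _)⟩
          rw [← heq] at h1 h2
          refine ⟨k + 1, by omega, le_rfl, ha.lt_nextIndex one_pos _, h1, h2.trans ?_⟩
          exact max_le le_rfl (by linarith [hyn.2])
    refine ⟨m, fun k hk => ?_⟩
    obtain ⟨n, hn, hnk, hkn, hyn⟩ := hgood k hk
    obtain ⟨h1, h2⟩ := hblock n hn ⟨hyn.1, hyn.2.trans (le_max_right _ _)⟩ k hnk hkn.le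
    refine ⟨h1, ?_⟩
    have := (hV.flow_mem hL hyn (sub_nonneg.2 (hmono hnk))).2
    linarith [min_le_right (Δ / 2) s]
  refine tendsto_order.2 ⟨fun b hb => Eventually.of_forall fun n =>
    hb.trans_le Metric.infDist_nonneg, fun b hb => ?_⟩
  obtain ⟨s, hs, hsU⟩ := hV.exists_sublevel_subset
    (U := {p | Metric.infDist p (stationarySet h G V) < b})
    (isOpen_lt (Metric.continuous_infDist_pt _) continuous_const)
    (fun p hp => by rw [Set.mem_ofPred_eq, Metric.infDist_zero_of_mem hp]; exact hb)
  obtain ⟨N, hN⟩ := key (s / 3) (by positivity)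
  refine eventually_atTop.2 ⟨N, fun k hk => hsU ?_⟩
  have := hN k hk
  rwa [mul_div_cancel₀ _ (by norm_num : (3 : ℝ) ≠ 0)] at this

end Liapunov

/-! ### Subexponential martingale differences and a maximal inequality -/

section Subexponential

open scoped ENNReal

theorem exp_le_one_add_add_sq_mul (y : ℝ) : Real.exp y ≤ 1 + y + y ^ 2 * Real.exp |y| := by
  have h1 : ∀ z : ℝ, Real.exp z - 1 ≤ z * Real.exp z := fun z => by
    have h := Real.add_one_le_exp (-z)
    have := mul_le_mul_of_nonneg_right h (Real.exp_pos z).le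
    rw [← Real.exp_add, neg_add_cancel, Real.exp_zero] at this
    linarith
  rcases le_total 0 y with hy | hy
  · rw [abs_of_nonneg hy]
    nlinarith [h1 y, mul_le_mul_of_nonneg_left (h1 y) hy]
  · rw [abs_of_nonpos hy]
    have h2 : y * Real.exp y - y ≤ y ^ 2 := by nlinarith [Real.add_one_le_exp y]
    have h3 : 1 ≤ Real.exp (-y) := Real.one_le_exp (by linarith)
    nlinarith [h1 y, mul_le_mul_of_nonneg_left h3 (sq_nonneg y)]

/-- The linear term is kept so that a zero mean can cancel it; the factor `z ^ 2` is absorbed by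
doubling the exponential rate. -/
theorem exp_mul_le_of_abs_le {θ l z : ℝ} (hθ : 0 < θ) (hl : |l| ≤ θ) :
    Real.exp (l * z) ≤ 1 + l * z + l ^ 2 * (2 / θ ^ 2) * Real.exp (2 * θ * |z|) := by
  have h1 := exp_le_one_add_add_sq_mul (l * z)
  have h2 : |l * z| ≤ θ * |z| := by rw [abs_mul]; gcongr
  have h3 : z ^ 2 ≤ 2 / θ ^ 2 * Real.exp (θ * |z|) := by
    have := Real.quadratic_le_exp_of_nonneg (x := θ * |z|) (by positivity)
    have h4 : (θ * |z|) ^ 2 / 2 ≤ Real.exp (θ * |z|) := by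
      nlinarith [mul_nonneg hθ.le (abs_nonneg z)]
    rw [mul_pow, sq_abs] at h4
    rw [div_mul_eq_mul_div, le_div_iff₀ (by positivity)]
    linarith
  calc Real.exp (l * z) ≤ 1 + l * z + (l * z) ^ 2 * Real.exp |l * z| := h1
    _ ≤ 1 + l * z + l ^ 2 * (2 / θ ^ 2 * Real.exp (θ * |z|)) * Real.exp (θ * |z|) := by
        rw [mul_pow]; gcongr
    _ = _ := by
        rw [show 2 * θ * |z| = θ * |z| + θ * |z| by ring, Real.exp_add]; ring

/-- A random variable with zero conditional mean and exponential conditional tails with respect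
to `m`. -/
structure IsSubexponential {Ω : Type*} (m : MeasurableSpace Ω)
    [m₀ : MeasurableSpace Ω] (μ : Measure Ω) (f : Ω → ℝ) (C₁ C₂ v₀ : ℝ) : Prop where
  measurable : Measurable f
  integrable : Integrable f μ
  setIntegral_eq_zero : ∀ A, MeasurableSet[m] A → ∫ ω in A, f ω ∂μ = 0
  tail : ∀ v ≥ v₀, ∀ A, MeasurableSet[m] A →
    μ (A ∩ {ω | v < |f ω|}) ≤ ENNReal.ofReal (C₁ * Real.exp (-C₂ * v)) * μ A

theorem IsSubexponential.neg {Ω : Type*} {m : MeasurableSpace Ω}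
    [m₀ : MeasurableSpace Ω] {μ : Measure Ω} {f : Ω → ℝ} {C₁ C₂ v₀ : ℝ}
    (hf : IsSubexponential m μ f C₁ C₂ v₀) :
    IsSubexponential m μ (-f) C₁ C₂ v₀ where
  measurable := hf.measurable.neg
  integrable := hf.integrable.neg
  setIntegral_eq_zero A hA := by
    simp only [Pi.neg_apply, integral_neg, hf.setIntegral_eq_zero A hA, neg_zero]
  tail := by simpa only [Pi.neg_apply, abs_neg] using hf.tail

/-- Slice by integer levels: each unit multiplies the integrand by `exp (C₂ / 2)` and the tail by
`exp (-C₂)`, which leaves a geometric series. `K` depends only on `C₁`, `C₂`, `v₀`, hence serves all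
times at once. -/
theorem exists_exp_abs_bound {C₁ C₂ : ℝ} (hC₁ : 0 < C₁) (hC₂ : 0 < C₂) (v₀ : ℝ) :
    ∃ K : ℝ, 0 ≤ K ∧ ∀ {Ω : Type*} (m : MeasurableSpace Ω)
      [m₀ : MeasurableSpace Ω] (μ : Measure Ω) (f : Ω → ℝ), m ≤ m₀ →
      IsSubexponential m μ f C₁ C₂ v₀ →
      ∀ A, MeasurableSet[m] A →
        ∫⁻ ω in A, ENNReal.ofReal (Real.exp (C₂ / 2 * |f ω|)) ∂μ ≤ ENNReal.ofReal K * μ A := by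
  -- Below `v₀` there is no tail information, so the integrand is bounded there by a constant.
  set J : ℕ := ⌈v₀⌉₊ with hJ
  set q : ℝ := Real.exp (-(C₂ / 2)) with hq
  have hq1 : q < 1 := Real.exp_lt_one_iff.2 (by linarith)
  set c : ℝ := C₁ * Real.exp (C₂ / 2 * (J + 1)) * Real.exp (-C₂ * J) with hc
  have hc0 : 0 ≤ c := by positivity
  have hsum : Summable fun i : ℕ => c * q ^ i :=
    (summable_geometric_of_lt_one (Real.exp_pos _).le hq1).mul_left c
  have hs0 : 0 ≤ ∑' i : ℕ, c * q ^ i := tsum_nonneg fun i => by positivity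
  refine ⟨Real.exp (C₂ / 2 * J) + ∑' i : ℕ, c * q ^ i, by positivity, ?_⟩
  intro Ω m m₀ μ f hm hf A hA
  have hA' := hm A hA
  have hpt : ∀ ω, ENNReal.ofReal (Real.exp (C₂ / 2 * |f ω|)) ≤
      ENNReal.ofReal (Real.exp (C₂ / 2 * J)) + ∑' i : ℕ,
        {ω | ((J + i : ℕ) : ℝ) < |f ω|}.indicator
          (fun _ => ENNReal.ofReal (Real.exp (C₂ / 2 * (J + i + 1)))) ω := by
    intro ω
    rcases le_or_gt |f ω| J with hle | hgt
    · refine le_add_right (ENNReal.ofReal_le_ofReal ?_)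
      gcongr
    · refine le_add_left ?_
      have h1 : J < ⌈|f ω|⌉₊ := Nat.lt_ceil.2 hgt
      obtain ⟨i, hi⟩ : ∃ i, ⌈|f ω|⌉₊ = J + i + 1 := ⟨⌈|f ω|⌉₊ - J - 1, by omega⟩
      refine le_trans ?_ (ENNReal.le_tsum i)
      rw [Set.indicator_of_mem]
      · refine ENNReal.ofReal_le_ofReal ?_
        have := Nat.le_ceil |f ω|
        rw [hi] at this
        push_cast at this
        gcongr
      · exact Nat.lt_ceil.1 (show J + i < ⌈|f ω|⌉₊ by omega)
  have hmeas : ∀ i : ℕ, MeasurableSet {ω | ((J + i : ℕ) : ℝ) < |f ω|} := fun i =>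
    measurableSet_lt measurable_const (hf.measurable.abs)
  calc ∫⁻ ω in A, ENNReal.ofReal (Real.exp (C₂ / 2 * |f ω|)) ∂μ
      ≤ ∫⁻ ω in A, (ENNReal.ofReal (Real.exp (C₂ / 2 * J)) + ∑' i : ℕ,
        {ω | ((J + i : ℕ) : ℝ) < |f ω|}.indicator
          (fun _ => ENNReal.ofReal (Real.exp (C₂ / 2 * (J + i + 1)))) ω) ∂μ :=
        lintegral_mono hpt
    _ = ENNReal.ofReal (Real.exp (C₂ / 2 * J)) * μ A + ∑' i : ℕ,
          ENNReal.ofReal (Real.exp (C₂ / 2 * (J + i + 1)))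
            * μ (A ∩ {ω | ((J + i : ℕ) : ℝ) < |f ω|}) := by
        rw [lintegral_add_left measurable_const, setLIntegral_const, lintegral_tsum]
        · congr 1
          refine tsum_congr fun i => ?_
          rw [lintegral_indicator_const (hmeas i), Measure.restrict_apply (hmeas i), Set.inter_comm]
        · exact fun i => (measurable_const.indicator (hmeas i)).aemeasurable
    _ ≤ ENNReal.ofReal (Real.exp (C₂ / 2 * J)) * μ A + ∑' i : ℕ,
          ENNReal.ofReal (c * q ^ i) * μ A := by
        refine add_le_add le_rfl (ENNReal.tsum_le_tsum fun i => ?_)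
        refine (mul_le_mul_right (hf.tail _ ?_ A hA) _).trans_eq ?_
        · push_cast
          linarith [Nat.le_ceil v₀, Nat.cast_nonneg (α := ℝ) i]
        · rw [← mul_assoc, ← ENNReal.ofReal_mul (Real.exp_pos _).le]
          congr 2
          rw [hc, hq, ← Real.exp_nat_mul]
          calc _ = C₁ * (Real.exp (C₂ / 2 * (J + i + 1)) * Real.exp (-C₂ * (J + i : ℕ))) := by ring
            _ = C₁ * (Real.exp (C₂ / 2 * (J + 1)) * Real.exp (-C₂ * J)
                  * Real.exp (i * -(C₂ / 2))) := by
                rw [← Real.exp_add, ← Real.exp_add, ← Real.exp_add]; push_cast; ring_nf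
            _ = _ := by ring
    _ = _ := by
        rw [ENNReal.tsum_mul_right, ← add_mul, ENNReal.ofReal_add (Real.exp_pos _).le hs0,
          ENNReal.ofReal_tsum_of_nonneg (fun i => by positivity) hsum]

/-- Integrate `exp_mul_le_of_abs_le` with `θ = C₂ / 4`: the mean term drops out, the remainder has
the integrable rate `C₂ / 2`, and `1 + u ≤ exp u` finishes. -/
theorem exists_mgf_bound {C₁ C₂ : ℝ} (hC₁ : 0 < C₁) (hC₂ : 0 < C₂) (v₀ : ℝ) :
    ∃ K : ℝ, 0 ≤ K ∧ ∀ {Ω : Type*} (m : MeasurableSpace Ω)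
      [m₀ : MeasurableSpace Ω] (μ : Measure Ω) [IsFiniteMeasure μ] (f : Ω → ℝ), m ≤ m₀ →
      IsSubexponential m μ f C₁ C₂ v₀ →
      ∀ l : ℝ, |l| ≤ C₂ / 4 → ∀ A, MeasurableSet[m] A →
        ∫⁻ ω in A, ENNReal.ofReal (Real.exp (l * f ω)) ∂μ
          ≤ ENNReal.ofReal (Real.exp (K * l ^ 2)) * μ A := by
  obtain ⟨K, hK, hbound⟩ := exists_exp_abs_bound hC₁ hC₂ v₀
  refine ⟨2 / (C₂ / 4) ^ 2 * K, by positivity, ?_⟩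
  intro Ω m m₀ μ _ f hm hf l hl A hA
  have hb := hbound m μ f hm hf A hA
  have hfm := hf.measurable
  have hpt := fun ω => exp_mul_le_of_abs_le (z := f ω) (by positivity : 0 < C₂ / 4) hl
  rw [show 2 * (C₂ / 4) = C₂ / 2 by ring] at hpt
  have hne : ENNReal.ofReal K * μ A ≠ ∞ :=
    ENNReal.mul_ne_top ENNReal.ofReal_ne_top (measure_ne_top _ _)
  have hEint : Integrable (fun ω => Real.exp (C₂ / 2 * |f ω|)) (μ.restrict A) := by
    refine ⟨by fun_prop, ?_⟩
    rw [hasFiniteIntegral_iff_ofReal (Eventually.of_forall fun ω => (Real.exp_pos _).le)]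
    exact lt_of_le_of_lt hb hne.lt_top
  have hE : ∫ ω in A, Real.exp (C₂ / 2 * |f ω|) ∂μ ≤ K * μ.real A := by
    rw [integral_eq_lintegral_of_nonneg_ae (Eventually.of_forall fun ω => (Real.exp_pos _).le)
      (by fun_prop)]
    refine (ENNReal.toReal_mono hne hb).trans_eq ?_
    rw [ENNReal.toReal_mul, ENNReal.toReal_ofReal hK, Measure.real]
  have hfi : Integrable f (μ.restrict A) := hf.integrable.integrableOn
  have h1 : Integrable (fun ω => 1 + l * f ω) (μ.restrict A) :=
    (integrable_const _).add (hfi.const_mul l)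
  have hG : Integrable (fun ω => 1 + l * f ω
      + l ^ 2 * (2 / (C₂ / 4) ^ 2) * Real.exp (C₂ / 2 * |f ω|)) (μ.restrict A) :=
    h1.add (hEint.const_mul _)
  calc ∫⁻ ω in A, ENNReal.ofReal (Real.exp (l * f ω)) ∂μ
      ≤ ∫⁻ ω in A, ENNReal.ofReal (1 + l * f ω
          + l ^ 2 * (2 / (C₂ / 4) ^ 2) * Real.exp (C₂ / 2 * |f ω|)) ∂μ :=
        lintegral_mono fun ω => ENNReal.ofReal_le_ofReal (hpt ω)
    _ = ENNReal.ofReal (∫ ω in A, (1 + l * f ω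
          + l ^ 2 * (2 / (C₂ / 4) ^ 2) * Real.exp (C₂ / 2 * |f ω|)) ∂μ) :=
        (ofReal_integral_eq_lintegral_ofReal hG
          (Eventually.of_forall fun ω => (Real.exp_pos _).le.trans (hpt ω))).symm
    _ = ENNReal.ofReal (μ.real A
          + l ^ 2 * (2 / (C₂ / 4) ^ 2) * ∫ ω in A, Real.exp (C₂ / 2 * |f ω|) ∂μ) := by
        rw [integral_add h1 (hEint.const_mul _),
          integral_add (integrable_const _) (hfi.const_mul l), integral_const_mul,
          integral_const_mul, hf.setIntegral_eq_zero A hA]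
        simp
    _ ≤ ENNReal.ofReal (Real.exp (2 / (C₂ / 4) ^ 2 * K * l ^ 2) * μ.real A) := by
        refine ENNReal.ofReal_le_ofReal ?_
        calc _ ≤ μ.real A + l ^ 2 * (2 / (C₂ / 4) ^ 2) * (K * μ.real A) := by gcongr
          _ = (2 / (C₂ / 4) ^ 2 * K * l ^ 2 + 1) * μ.real A := by ring
          _ ≤ _ := by gcongr; exact Real.add_one_le_exp _
    _ = _ := by
        rw [ENNReal.ofReal_mul (Real.exp_pos _).le, Measure.real,
          ENNReal.ofReal_toReal (measure_ne_top _ _)]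

/-- A bound for integrals over the sets of a sub-`σ`-algebra extends to weighted integrals. -/
theorem lintegral_mul_le_of_forall_setLIntegral_le {Ω : Type*}
    {m : MeasurableSpace Ω} [m₀ : MeasurableSpace Ω] {μ : Measure Ω} (hm : m ≤ m₀)
    {g W : Ω → ℝ≥0∞} (hg : Measurable g)
    {c : ℝ≥0∞} (h : ∀ A, MeasurableSet[m] A → ∫⁻ ω in A, g ω ∂μ ≤ c * μ A)
    (hW : Measurable[m] W) : ∫⁻ ω, W ω * g ω ∂μ ≤ c * ∫⁻ ω, W ω ∂μ := by
  -- Read as an inequality between measures on the smaller `σ`-algebra, the hypothesis integrates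
  -- against any weight measurable there.
  have hle : (μ.withDensity g).trim hm ≤ c • μ.trim hm := by
    refine Measure.le_iff.2 fun A hA => ?_
    rw [trim_measurableSet_eq hm hA, withDensity_apply _ (hm A hA), Measure.smul_apply,
      trim_measurableSet_eq hm hA, smul_eq_mul]
    exact h A hA
  calc ∫⁻ ω, W ω * g ω ∂μ = ∫⁻ ω, W ω ∂(μ.withDensity g) := by
        rw [lintegral_withDensity_eq_lintegral_mul μ hg (hW.mono hm le_rfl)]
        simp only [Pi.mul_apply, mul_comm]
    _ = ∫⁻ ω, W ω ∂((μ.withDensity g).trim hm) := (lintegral_trim hm hW).symm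
    _ ≤ ∫⁻ ω, W ω ∂(c • μ.trim hm) := lintegral_mono' hle le_rfl
    _ = c * ∫⁻ ω, W ω ∂μ := by rw [lintegral_smul_measure, lintegral_trim hm hW, smul_eq_mul]

/-- Ville's maximal inequality. -/
theorem mul_measure_exists_le {Ω : Type*} [m₀ : MeasurableSpace Ω] {μ : Measure Ω}
    {F : ℕ → MeasurableSpace Ω} (hF : Monotone F) (hF₀ : ∀ n, F n ≤ m₀) {X : ℕ → Ω → ℝ≥0∞}
    (hX : ∀ n, Measurable[F n] (X n))
    (hsuper : ∀ n B, MeasurableSet[F n] B → ∫⁻ ω in B, X (n + 1) ω ∂μ ≤ ∫⁻ ω in B, X n ω ∂μ)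
    (κ : ℝ≥0∞) : κ * μ {ω | ∃ n, κ ≤ X n ω} ≤ ∫⁻ ω, X 0 ω ∂μ := by
  set E : ℕ → Set Ω := fun n => {ω | ∃ j < n, κ ≤ X j ω} with hE
  have hEsucc : ∀ n, E (n + 1) = E n ∪ {ω | κ ≤ X n ω} := by
    intro n
    ext ω
    simp only [hE, Set.mem_ofPred_eq, Set.mem_union, Nat.lt_succ_iff_lt_or_eq]
    constructor
    · rintro ⟨j, hj | rfl, h⟩
      · exact Or.inl ⟨j, hj, h⟩
      · exact Or.inr h
    · rintro (⟨j, hj, h⟩ | h)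
      · exact ⟨j, Or.inl hj, h⟩
      · exact ⟨n, Or.inr rfl, h⟩
  have hlev : ∀ n, MeasurableSet[F n] {ω | κ ≤ X n ω} := fun n =>
    @measurableSet_le _ _ _ _ _ (F n) _ _ _ _ _ measurable_const (hX n)
  have hEm : ∀ n, MeasurableSet[F n] (E (n + 1)) := by
    intro n
    induction n with
    | zero =>
      rw [hEsucc, show E 0 = ∅ by ext; simp [hE], Set.empty_union]
      exact hlev 0
    | succ n ih =>
      rw [hEsucc]
      exact MeasurableSet.union (hF n.le_succ _ ih) (hlev _)
  have hEm' : ∀ n, MeasurableSet[F n] (E n) := by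
    intro n
    cases n with
    | zero => rw [show E 0 = ∅ by ext; simp [hE]]; exact @MeasurableSet.empty _ (F 0)
    | succ n => exact hF n.le_succ _ (hEm n)
  -- The left side is nonincreasing in `n`: points that first reach the level at time `n` move from
  -- the integral, where they weigh at least `κ`, to the first term, where they weigh exactly `κ`.
  have hQ : ∀ n, κ * μ (E n) + ∫⁻ ω in (E n)ᶜ, X n ω ∂μ ≤ ∫⁻ ω, X 0 ω ∂μ := by
    intro n
    induction n with
    | zero => simp [show E 0 = ∅ by ext; simp [hE]]
    | succ n ih =>
      refine le_trans ?_ ih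
      have hsub : E n ⊆ E (n + 1) := by rw [hEsucc]; exact Set.subset_union_left
      have hd : MeasurableSet (E (n + 1) \ E n) := (hF₀ n _ (hEm n)).diff (hF₀ n _ (hEm' n))
      have h1 : μ (E (n + 1)) = μ (E n) + μ (E (n + 1) \ E n) := by
        rw [← measure_union Set.disjoint_sdiff_right hd, Set.union_sdiff_cancel hsub]
      have h2 : ∫⁻ ω in (E n)ᶜ, X n ω ∂μ
          = ∫⁻ ω in E (n + 1) \ E n, X n ω ∂μ + ∫⁻ ω in (E (n + 1))ᶜ, X n ω ∂μ := by
        rw [← lintegral_union (hF₀ n _ (hEm n)).compl]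
        · congr 2
          ext ω
          have := @hsub ω
          simp only [Set.mem_compl_iff, Set.mem_union, Set.mem_sdiff]
          tauto
        · exact Set.disjoint_left.2 fun ω h h' => h' h.1
      have h3 : κ * μ (E (n + 1) \ E n) ≤ ∫⁻ ω in E (n + 1) \ E n, X n ω ∂μ := by
        rw [← setLIntegral_const]
        refine setLIntegral_mono' hd fun ω hω => ?_
        have := hω.1
        rw [hEsucc] at this
        exact this.resolve_left hω.2
      have h4 := hsuper n (E (n + 1))ᶜ (MeasurableSet.compl (hEm n))
      rw [h1, h2, mul_add, add_assoc]
      gcongr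
  have hmono : Monotone E := fun i j hij ω ⟨k, hk, h⟩ => ⟨k, hk.trans_le hij, h⟩
  have hun : {ω | ∃ n, κ ≤ X n ω} = ⋃ n, E n := by
    ext ω
    simp only [hE, Set.mem_ofPred_eq, Set.mem_iUnion]
    exact ⟨fun ⟨n, h⟩ => ⟨n + 1, n, n.lt_succ_self, h⟩, fun ⟨_, j, _, h⟩ => ⟨j, h⟩⟩
  rw [hun, hmono.measure_iUnion, ENNReal.mul_iSup]
  exact iSup_le fun n => le_self_add.trans (hQ n)

/-- Maximal inequality for weighted sums of subexponential martingale differences. -/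
theorem exists_maximal_bound {C₁ C₂ : ℝ} (hC₁ : 0 < C₁) (hC₂ : 0 < C₂) (v₀ : ℝ) :
    ∃ K : ℝ, 0 < K ∧ ∀ {Ω : Type*} [m₀ : MeasurableSpace Ω] (μ : Measure Ω) [IsFiniteMeasure μ]
      (F : ℕ → MeasurableSpace Ω) (f : ℕ → Ω → ℝ) (α : ℕ → ℝ) (b : ℝ), Monotone F →
      (∀ n, F n ≤ m₀) → (∀ n, IsSubexponential (F n) μ (f n) C₁ C₂ v₀) →
      (∀ n, Measurable[F (n + 1)] (f n)) → (∀ n, 0 ≤ α n) → 0 < b →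
      (∀ n, ∑ k ∈ Finset.range n, α k ^ 2 ≤ b) → ∀ A, MeasurableSet[F 0] A → ∀ ε : ℝ,
        μ (A ∩ {ω | ∃ n, ε ≤ ∑ k ∈ Finset.range n, α k * f k ω})
          ≤ ENNReal.ofReal (K * Real.exp (-(C₂ / 4 * ε / Real.sqrt b))) * μ A := by
  obtain ⟨K, hK, hmgf⟩ := exists_mgf_bound hC₁ hC₂ v₀
  refine ⟨Real.exp (K * (C₂ / 4) ^ 2), Real.exp_pos _, ?_⟩
  intro Ω m₀ μ _ F f α b hF hF₀ hf hfF hα hb hαb A hA ε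
  have hsb := Real.sqrt_pos.2 hb
  -- Each `α k ≤ √b`, so every `l * α k` is in the range of the moment bound. The compensator is at
  -- most `K * l ^ 2 * b = K * (C₂ / 4) ^ 2`, a constant, and the exponent is linear in `ε / √b`.
  set l : ℝ := C₂ / 4 / Real.sqrt b with hl
  have hl0 : 0 ≤ l := by positivity
  have hlα : ∀ k, |l * α k| ≤ C₂ / 4 := by
    intro k
    rw [abs_of_nonneg (mul_nonneg hl0 (hα k)), hl, div_mul_eq_mul_div, div_le_iff₀ hsb]
    gcongr
    refine Real.le_sqrt_of_sq_le (le_trans ?_ (hαb (k + 1)))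
    exact Finset.single_le_sum (f := fun k => α k ^ 2) (fun _ _ => sq_nonneg _)
      (Finset.mem_range.2 k.lt_succ_self)
  set Y : ℕ → Ω → ℝ := fun n ω => ∑ k ∈ Finset.range n, (l * α k * f k ω - K * (l * α k) ^ 2)
    with hY
  have hYm : ∀ n, Measurable[F n] (Y n) := fun n =>
    Finset.measurable_fun_sum _ fun k hk =>
      (Measurable.const_mul ((hfF k).mono (hF (Finset.mem_range.1 hk)) le_rfl) _).sub_const _
  -- The indicator of `A` localizes the exponential supermartingale: its initial mass is `μ A`,
  -- which produces the conditional form of the bound.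
  set X : ℕ → Ω → ℝ≥0∞ := fun n => A.indicator fun ω => ENNReal.ofReal (Real.exp (Y n ω)) with hX
  have hXm : ∀ n, Measurable[F n] (X n) := fun n =>
    Measurable.indicator (Measurable.ennreal_ofReal (Real.measurable_exp.comp (hYm n)))
      (hF n.zero_le _ hA)
  have hsuper : ∀ n B, MeasurableSet[F n] B →
      ∫⁻ ω in B, X (n + 1) ω ∂μ ≤ ∫⁻ ω in B, X n ω ∂μ := by
    intro n B hB
    set c : ℝ≥0∞ := ENNReal.ofReal (Real.exp (-(K * (l * α n) ^ 2))) with hc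
    have hstep := lintegral_mul_le_of_forall_setLIntegral_le (hF₀ n)
      (g := fun ω => ENNReal.ofReal (Real.exp (l * α n * f n ω)))
      (W := fun ω => c * B.indicator (X n) ω)
      (by have := (hf n).measurable; fun_prop)
      (hmgf (F n) μ (f n) (hF₀ n) (hf n) (l * α n) (hlα n))
      (Measurable.const_mul (Measurable.indicator (hXm n) hB) c)
    have hBm := hF₀ n B hB
    have hXn : Measurable (X n) := (hXm n).mono (hF₀ n) le_rfl
    rw [lintegral_const_mul _ (hXn.indicator hBm), ← mul_assoc, hc,
      ← ENNReal.ofReal_mul (Real.exp_pos _).le, ← Real.exp_add, add_neg_cancel, Real.exp_zero,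
      ENNReal.ofReal_one, one_mul, lintegral_indicator hBm] at hstep
    refine le_of_eq_of_le ?_ hstep
    rw [← lintegral_indicator hBm]
    refine lintegral_congr fun ω => ?_
    by_cases hωB : ω ∈ B
    · by_cases hωA : ω ∈ A
      · simp only [hX, Set.indicator_of_mem hωB, Set.indicator_of_mem hωA]
        rw [← ENNReal.ofReal_mul (Real.exp_pos _).le, ← ENNReal.ofReal_mul (by positivity),
          ← Real.exp_add, ← Real.exp_add]
        simp only [hY, Finset.sum_range_succ]
        congr 2
        ring
      · simp [hX, hωB, hωA]
    · simp [hωB]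
  have hville := mul_measure_exists_le hF hF₀ hXm hsuper
    (ENNReal.ofReal (Real.exp (l * ε - K * (C₂ / 4) ^ 2)))
  have hX0 : ∫⁻ ω, X 0 ω ∂μ = μ A := by
    simp only [hX, hY, Finset.range_zero, Finset.sum_empty, Real.exp_zero, ENNReal.ofReal_one]
    rw [lintegral_indicator_const (hF₀ 0 _ hA), one_mul]
  rw [hX0] at hville
  have hsub : A ∩ {ω | ∃ n, ε ≤ ∑ k ∈ Finset.range n, α k * f k ω} ⊆
      {ω | ∃ n, ENNReal.ofReal (Real.exp (l * ε - K * (C₂ / 4) ^ 2)) ≤ X n ω} := by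
    rintro ω ⟨hωA, n, hn⟩
    refine ⟨n, ?_⟩
    simp only [hX, Set.indicator_of_mem hωA]
    refine ENNReal.ofReal_le_ofReal (Real.exp_le_exp.2 ?_)
    have h1 : Y n ω = l * ∑ k ∈ Finset.range n, α k * f k ω
        - K * l ^ 2 * ∑ k ∈ Finset.range n, α k ^ 2 := by
      simp only [hY, Finset.sum_sub_distrib, Finset.mul_sum, mul_pow, mul_assoc]
    have h2 : K * l ^ 2 * ∑ k ∈ Finset.range n, α k ^ 2 ≤ K * (C₂ / 4) ^ 2 := by
      calc _ ≤ K * l ^ 2 * b := by gcongr; exact hαb n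
        _ = _ := by
          rw [hl, div_pow, Real.sq_sqrt hb.le]; field_simp
    rw [h1]
    linarith [mul_le_mul_of_nonneg_left hn hl0]
  calc _ ≤ _ := measure_mono hsub
    _ = ENNReal.ofReal (Real.exp (K * (C₂ / 4) ^ 2) * Real.exp (-(C₂ / 4 * ε / Real.sqrt b)))
        * (ENNReal.ofReal (Real.exp (l * ε - K * (C₂ / 4) ^ 2))
          * μ {ω | ∃ n, ENNReal.ofReal (Real.exp (l * ε - K * (C₂ / 4) ^ 2)) ≤ X n ω}) := by
        rw [← mul_assoc, ← ENNReal.ofReal_mul (by positivity), ← Real.exp_add, ← Real.exp_add,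
          show K * (C₂ / 4) ^ 2 + -(C₂ / 4 * ε / Real.sqrt b) + (l * ε - K * (C₂ / 4) ^ 2) = 0 by
            rw [hl]; ring, Real.exp_zero, ENNReal.ofReal_one, one_mul]
    _ ≤ _ := by gcongr

end Subexponential

/-! ### Tails of the squared step sizes -/

section StepSize

variable {a : ℕ → ℝ}

theorem IsStepSize.summable_sq_shift (ha : IsStepSize a) (n : ℕ) :
    Summable fun m => a (n + m) ^ 2 := by
  simpa only [add_comm n] using (summable_nat_add_iff n).2 ha.summable_sq

theorem IsStepSize.sum_sq_le_tailSq (ha : IsStepSize a) (n k : ℕ) :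
    ∑ j ∈ Finset.range k, a (n + j) ^ 2 ≤ tailSq a n :=
  (ha.summable_sq_shift n).sum_le_tsum _ fun _ _ => sq_nonneg _

theorem IsStepSize.tailSq_pos (ha : IsStepSize a) (n : ℕ) : 0 < tailSq a n :=
  lt_of_lt_of_le (by have := ha.pos n; simpa using pow_pos this 2) (ha.sum_sq_le_tailSq n 1)

theorem tendsto_tailSq (a : ℕ → ℝ) : Tendsto (tailSq a) atTop (𝓝 0) := by
  have := tendsto_sum_nat_add fun n => a n ^ 2
  simp only [add_comm] at this
  exact this

/-- With `u = b ^ (1 / 4)` the exponents are `κ / u ^ 2` and `q / u`; as `u → 0` the first outgrows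
the second and also absorbs the factor `C`. -/
theorem IsStepSize.exists_exp_tailSq_le (ha : IsStepSize a) {C κ : ℝ} (hC : 0 < C)
    (hκ : 0 < κ) (q : ℝ) : ∃ N, ∀ n ≥ N,
      C * Real.exp (-(κ / Real.sqrt (tailSq a n)))
        ≤ 1 * Real.exp (-(q / tailSq a n ^ (1 / 4 : ℝ))) := by
  -- For `1 / u ≥ s₀` both `C ≤ C / u` and `q + C ≤ κ / u` hold, whence `C + q / u ≤ κ / u ^ 2`.
  set s₀ : ℝ := max 1 ((q + C) / κ) with hs₀
  have hs₀1 : 1 ≤ s₀ := le_max_left _ _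
  have hs₀0 : 0 < s₀ := by linarith
  obtain ⟨N, hN⟩ := eventually_atTop.1
    ((tendsto_tailSq a).eventually (ge_mem_nhds (show 0 < (1 / s₀) ^ 4 by positivity)))
  refine ⟨N, fun n hn => ?_⟩
  have hb := ha.tailSq_pos n
  set u : ℝ := tailSq a n ^ (1 / 4 : ℝ) with hu
  have hu0 : 0 < u := Real.rpow_pos_of_pos hb _
  have hu4 : u ^ 4 = tailSq a n := by
    rw [hu, ← Real.rpow_natCast, ← Real.rpow_mul hb.le]; norm_num
  have hsq : Real.sqrt (tailSq a n) = u ^ 2 := by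
    rw [← hu4, show u ^ 4 = (u ^ 2) ^ 2 by ring, Real.sqrt_sq (by positivity)]
  have hule : u ≤ 1 / s₀ := by
    have := hN n hn
    rw [← hu4] at this
    exact le_of_pow_le_pow_left₀ (by norm_num) (by positivity) this
  have hs : s₀ ≤ 1 / u := by
    rw [le_div_iff₀ hu0]
    rw [le_div_iff₀ hs₀0] at hule
    linarith
  have h1 : q + C ≤ κ * (1 / u) := by
    have := (le_max_right 1 ((q + C) / κ)).trans hs
    rw [div_le_iff₀ hκ] at this
    linarith
  have h2 : C + q / u ≤ κ / u ^ 2 := by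
    have h3 : C ≤ C * (1 / u) := le_mul_of_one_le_right hC.le (hs₀1.trans hs)
    have h4 : (q + C) * (1 / u) ≤ κ * (1 / u) * (1 / u) := by gcongr
    calc C + q / u ≤ (q + C) * (1 / u) := by rw [add_mul, mul_one_div q]; linarith
      _ ≤ _ := h4
      _ = _ := by field_simp
  rw [hsq, one_mul]
  calc C * Real.exp (-(κ / u ^ 2)) ≤ Real.exp C * Real.exp (-(κ / u ^ 2)) := by
        gcongr; linarith [Real.add_one_le_exp C]
    _ = Real.exp (C - κ / u ^ 2) := by rw [← Real.exp_add, sub_eq_add_neg]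
    _ ≤ _ := Real.exp_le_exp.2 (by linarith)

theorem IsStepSize.sum_Ico_sq_le_tailSq (ha : IsStepSize a) (n k : ℕ) :
    ∑ j ∈ Finset.Ico n k, a j ^ 2 ≤ tailSq a n := by
  rw [Finset.sum_Ico_eq_sum_range]
  exact ha.sum_sq_le_tailSq n _

/-- A difference of two partial sums from `m`. Thus one bound from `m` on controls the noise in
every later block. -/
theorem norm_sum_Ico_le {d : ℕ} {w : ℕ → Space d} {m : ℕ} {ε : ℝ}
    (hw : ∀ n, ‖∑ k ∈ Finset.range n, w (m + k)‖ ≤ ε) {n k : ℕ} (hmn : m ≤ n) (hnk : n ≤ k) :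
    ‖∑ j ∈ Finset.Ico n k, w j‖ ≤ 2 * ε := by
  have h1 := Finset.sum_Ico_consecutive w hmn hnk
  rw [Finset.sum_Ico_eq_sum_range w m n, Finset.sum_Ico_eq_sum_range w m k] at h1
  rw [eq_sub_of_add_eq' h1]
  linarith [norm_sub_le (∑ k ∈ Finset.range (k - m), w (m + k))
    (∑ k ∈ Finset.range (n - m), w (m + k)), hw (n - m), hw (k - m)]

end StepSize

/-! ### Pathwise trapping and asymptotic tracking -/

section Deterministic

variable {d : ℕ} {h : Space d → Space d} {L : ℝ≥0} {a : ℕ → ℝ}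

theorem norm_flow_le (hL : LipschitzWith L h) {p : Space d} {ρ S : ℝ} (hp : ‖p‖ ≤ ρ) :
    ∀ u ∈ Set.Icc 0 S, ‖flow hL p u‖ ≤ gronwallBound ρ L ‖h 0‖ S := fun _ hu =>
  (flow_isForwardSolution hL p).norm_le hL (by rwa [flow_zero]) hu.1 hu.2

/-- If the accumulated noise from time `n₀` on stays small, the iterates are bounded and return to
`B` at the start of each block. -/
theorem Traps.exists_trapping_constants (hL : LipschitzWith L h) (ha : IsStepSize a)
    {B : Set (Space d)} (hBbdd : Bornology.IsBounded B) {T : ℝ} (hT : 0 < T) {δ : ℝ} (hδ : 0 < δ)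
    (htraps : Traps h a T B δ) :
    ∃ R : ℝ, 0 ≤ R ∧ ∃ ε > 0, ∃ N, ∀ n₀ ≥ N, ∀ y w : ℕ → Space d,
      (∀ k ≥ n₀, ‖y k‖ ≤ R → y (k + 1) = y k + a k • h (y k) + w k) →
      (∀ n, ‖∑ k ∈ Finset.range n, w (n₀ + k)‖ ≤ ε) → y n₀ ∈ B →
      (∀ k ≥ n₀, ‖y k‖ ≤ R) ∧ ∀ N', ∃ n ≥ N', y n ∈ B := by
  obtain ⟨ρ, hρ0, hρ⟩ : ∃ ρ : ℝ, 0 ≤ ρ ∧ ∀ p ∈ B, ‖p‖ ≤ ρ := by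
    obtain ⟨ρ, hρ⟩ := isBounded_iff_forall_norm_le.1 hBbdd
    exact ⟨max ρ 0, le_max_right _ _, fun p hp => (hρ p hp).trans (le_max_left _ _)⟩
  set S := T + 1 with hS
  set R₀ := gronwallBound ρ L ‖h 0‖ S with hR₀
  have hR₀0 : 0 ≤ R₀ := by
    have := gronwallBound_mono hρ0 (norm_nonneg (h 0)) L.2 (show 0 ≤ S by positivity)
    rw [gronwallBound_x0] at this
    exact hρ0.trans this
  set C := L * R₀ + ‖h 0‖ with hC
  have hC0 : 0 ≤ C := by positivity
  set e := Real.exp (L * S) with he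
  have he0 : 0 < e := Real.exp_pos _
  -- The `1` keeps iterates within `R₀ + 1`; the `δ / 4`, with another `δ / 4` for interpolation,
  -- keeps the block deviation below `δ`.
  set η := min 1 (δ / 4) with hη
  have hη0 : 0 < η := by positivity
  obtain ⟨N₁, hN₁⟩ := eventually_atTop.1
    (ha.tendsto_zero.eventually (ge_mem_nhds (show 0 < min 1 (δ / 4 / (C + 1)) by positivity)))
  obtain ⟨N₂, hN₂⟩ := eventually_atTop.1
    ((tendsto_tailSq a).eventually (ge_mem_nhds (show 0 < η / 2 / (e * (L * C + 1)) by positivity)))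
  -- Doubled by `norm_sum_Ico_le` and multiplied by the Gronwall factor `e`, this `ε` gives `η / 2`.
  -- The Euler errors use at most the other half.
  refine ⟨R₀ + 1, by positivity, η / (4 * e), by positivity, max N₁ N₂, ?_⟩
  intro n₀ hn₀ y w hy hw hy₀
  have hblock : ∀ n ≥ n₀, y n ∈ B →
      y (nextIndex a T n) ∈ B ∧ ∀ k, n ≤ k → k ≤ nextIndex a T n → ‖y k‖ ≤ R₀ + 1 := by
    intro n hn hyn
    have hnN₁ : N₁ ≤ n := (le_max_left _ _).trans (hn₀.trans hn)
    have hnN₂ : N₂ ≤ n := (le_max_right _ _).trans (hn₀.trans hn)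
    have hlen : time a (nextIndex a T n) ≤ time a n + S := by
      have := ha.time_nextIndex_le hT (n := n) (α := 1) fun k hk =>
        (hN₁ k (hnN₁.trans hk)).trans (min_le_left _ _)
      linarith
    have hflow := norm_flow_le (S := S) hL (hρ _ hyn)
    have hhflow : ∀ u ∈ Set.Icc 0 S, ‖h (flow hL (y n) u)‖ ≤ C := fun u hu =>
      (norm_le_of_lipschitz hL _).trans (by rw [hC]; gcongr; exact hflow u hu)
    have herr : (2 * (η / (4 * e)) + L * C * tailSq a n) * e ≤ η := by
      have h1 : 2 * (η / (4 * e)) * e = η / 2 := by field_simp; norm_num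
      have h2 := hN₂ n hnN₂
      rw [le_div_iff₀ (by positivity)] at h2
      have h3 := (ha.tailSq_pos n).le
      have h4 : L * C * tailSq a n * e ≤ tailSq a n * (e * (L * C + 1)) := by
        nlinarith [mul_nonneg h3 he0.le]
      linarith [add_mul (2 * (η / (4 * e))) (L * C * tailSq a n) e]
    have htrack : ∀ k, n ≤ k → k ≤ nextIndex a T n →
        ‖y k - flow hL (y n) (time a k - time a n)‖ ≤ η := fun k hk hkm =>
      (norm_sub_flow_le hL ha (fun j hj _ hyj => hy j (hn.trans hj) hyj)
        (fun j hj _ => norm_sum_Ico_le hw hn hj) (ha.sum_Ico_sq_le_tailSq n) hlen hC0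
        hhflow hflow (by linarith [min_le_left 1 (δ / 4)]) hk hkm).trans herr
    refine ⟨htraps y n _ (solvesOnBlock_flow hL T n (y n)) hyn ?_, fun k hk hkm => ?_⟩
    · refine (blockDeviation_flow_le hL ha hT htrack
        (fun k hk => hN₁ k (hnN₁.trans hk)) hlen hC0 hhflow).trans_lt ?_
      have h1 : C * min 1 (δ / 4 / (C + 1)) ≤ δ / 4 := by
        calc _ ≤ (C + 1) * (δ / 4 / (C + 1)) := by gcongr; linarith; exact min_le_right _ _
          _ = δ / 4 := by field_simp
      linarith [min_le_right 1 (δ / 4)]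
    · have h1 := htrack k hk hkm
      have h2 := hflow (time a k - time a n)
        ⟨by linarith [ha.time_strictMono.monotone hk],
          by linarith [ha.time_strictMono.monotone hkm]⟩
      linarith [norm_le_norm_add_norm_sub' (y k) (flow hL (y n) (time a k - time a n)),
        min_le_left 1 (δ / 4)]
  have hcover : ∀ k ≥ n₀, ∃ n ≥ n₀, n ≤ k ∧ k < nextIndex a T n ∧ y n ∈ B := by
    intro k hk
    induction k, hk using Nat.le_induction with
    | base => exact ⟨n₀, le_rfl, le_rfl, ha.lt_nextIndex hT _, hy₀⟩
    | succ k hk ih =>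
      obtain ⟨n, hn, hnk, hkn, hyn⟩ := ih
      rcases lt_or_ge (k + 1) (nextIndex a T n) with hlt | hge
      · exact ⟨n, hn, by omega, hlt, hyn⟩
      · have heq : k + 1 = nextIndex a T n := by omega
        exact ⟨k + 1, by omega, le_rfl, ha.lt_nextIndex hT _, heq ▸ (hblock n hn hyn).1⟩
  refine ⟨fun k hk => ?_, fun N' => ?_⟩
  · obtain ⟨n, hn, hnk, hkn, hyn⟩ := hcover k hk
    exact (hblock n hn hyn).2 k hnk hkn.le
  · obtain ⟨n, hn, hnk, hkn, hyn⟩ := hcover (max n₀ N') (le_max_left _ _)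
    exact ⟨_, (le_max_right n₀ N').trans hkn.le, (hblock n hn hyn).1⟩

/-- Bounded iterates whose noise is summable asymptotically follow the flow. -/
theorem exists_forall_norm_sub_flow_le (hL : LipschitzWith L h) (ha : IsStepSize a)
    {y w : ℕ → Space d} {n₀ : ℕ} {R : ℝ} (hR : ∀ k ≥ n₀, ‖y k‖ ≤ R)
    (hy : ∀ k ≥ n₀, y (k + 1) = y k + a k • h (y k) + w k)
    (hw : ∀ ε > 0, ∃ m, ∀ n, ‖∑ k ∈ Finset.range n, w (m + k)‖ ≤ ε) (S : ℝ) {η : ℝ}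
    (hη : 0 < η) : ∃ N, ∀ n ≥ N, ∀ k ≥ n, time a k ≤ time a n + S →
      ‖y k - flow hL (y n) (time a k - time a n)‖ ≤ η := by
  -- The absolute value keeps `C` nonnegative without any sign condition on `R` or `S`.
  set C := L * |gronwallBound R L ‖h 0‖ S| + ‖h 0‖ with hC
  have hC0 : 0 ≤ C := by positivity
  set e := Real.exp (L * S) with he
  have he0 : 0 < e := Real.exp_pos _
  obtain ⟨m, hm⟩ := hw (η / (4 * e)) (by positivity)
  obtain ⟨N, hN⟩ := eventually_atTop.1
    ((tendsto_tailSq a).eventually (ge_mem_nhds (show 0 < η / 2 / (e * (L * C + 1)) by positivity)))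
  refine ⟨max n₀ (max m N), fun n hn k hk hkS => ?_⟩
  have hn0 : n₀ ≤ n := (le_max_left _ _).trans hn
  have hnm : m ≤ n := ((le_max_left _ _).trans (le_max_right _ _)).trans hn
  have hnN : N ≤ n := ((le_max_right _ _).trans (le_max_right _ _)).trans hn
  refine (norm_sub_flow_le_of_recursion hL ha (C := C) (fun j hj _ => hy j (hn0.trans hj))
    (fun j hj _ => norm_sum_Ico_le hm hnm hj) (ha.sum_Ico_sq_le_tailSq n) hkS hC0
    (fun u hu => ?_) hk le_rfl).trans ?_
  · refine (norm_le_of_lipschitz hL _).trans ?_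
    rw [hC]
    gcongr
    exact (norm_flow_le hL (hR n hn0) u hu).trans (le_abs_self _)
  · have h1 : 2 * (η / (4 * e)) * e = η / 2 := by field_simp; norm_num
    have h2 := hN n hnN
    rw [le_div_iff₀ (by positivity)] at h2
    have h3 := (ha.tailSq_pos n).le
    have h4 : L * C * tailSq a n * e ≤ tailSq a n * (e * (L * C + 1)) := by
      nlinarith [mul_nonneg h3 he0.le]
    linarith [add_mul (2 * (η / (4 * e))) (L * C * tailSq a n) e]

end Deterministic

/-! ### Truncated noise and the lock-in probability -/

section Noise

open scoped ENNReal

theorem history_mono {Ω : Type*} {d : ℕ} (x M : ℕ → Ω → Space d) : Monotone (history x M) :=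
  fun _ _ hmn =>
    sup_le_sup_left (biSup_mono fun _ hk => Finset.Icc_subset_Icc_right hmn hk) _

theorem measurable_history_noise {Ω : Type*} {d : ℕ} (x M : ℕ → Ω → Space d)
    (n : ℕ) :
    Measurable[history x M (n + 1)] (M (n + 1)) := by
  refine measurable_iff_comap_le.2 (le_sup_of_le_right ?_)
  exact le_iSup₂ (f := fun k (_ : k ∈ Finset.Icc 1 (n + 1)) =>
    MeasurableSpace.comap (M k) inferInstance) (n + 1) (Finset.mem_Icc.2 ⟨by omega, le_rfl⟩)

theorem measurable_history_iterate {Ω : Type*} {d : ℕ} {x M : ℕ → Ω → Space d}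
    {h : Space d → Space d} {L : ℝ≥0}
    (hL : LipschitzWith L h) {a : ℕ → ℝ}
    (hx : ∀ n ω, x (n + 1) ω = x n ω + a n • (h (x n ω) + M (n + 1) ω)) (n : ℕ) :
    Measurable[history x M n] (x n) := by
  induction n with
  | zero => exact measurable_iff_comap_le.2 le_sup_left
  | succ n ih =>
    have h1 : Measurable[history x M (n + 1)] (x n) := ih.mono (history_mono x M n.le_succ) le_rfl
    have h2 := measurable_history_noise x M n
    rw [show x (n + 1) = fun ω => x n ω + a n • (h (x n ω) + M (n + 1) ω) from funext (hx n)]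
    exact h1.add (((hL.continuous.measurable.comp h1).add h2).const_smul (a n))

variable {Ω : Type*} [m₀ : MeasurableSpace Ω] {μ : Measure Ω} {d : ℕ} {x M : ℕ → Ω → Space d}

theorem IsNoise.history_le (hM : IsNoise μ x M) (n : ℕ) : history x M n ≤ m₀ := by
  refine sup_le hM.measurable_init.comap_le (iSup₂_le fun k hk => ?_)
  obtain ⟨j, rfl⟩ : ∃ j, k = j + 1 := ⟨k - 1, by have := (Finset.mem_Icc.1 hk).1; omega⟩
  exact (hM.measurable j).comap_le

/-- The noise at those times where the iterate is in the ball of radius `R`. -/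
noncomputable def truncatedNoise (x M : ℕ → Ω → Space d) (R : ℝ) (k : ℕ) : Ω → Space d :=
  {ω | ‖x k ω‖ ≤ R}.indicator (M (k + 1))

/-- On `‖x k‖ ≤ R` the normalization `1 + ‖x k‖` is at most `1 + R`, which divides the tail rate by
`1 + R`. The truncation event belongs to the history at time `k`, so the conditional mean stays
zero. -/
theorem exists_isSubexponential [IsProbabilityMeasure μ] (hM : IsNoise μ x M)
    (hxm : ∀ n, Measurable[history x M n] (x n)) {C₁ C₂ : ℝ}
    (htail : ExpTail μ x M C₁ C₂) {R : ℝ} (hR : 0 ≤ R) :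
    ∃ v₀, ∀ k i, IsSubexponential (history x M k) μ (fun ω => truncatedNoise x M R k ω i)
      C₁ (C₂ / (1 + R)) v₀ := by
  obtain ⟨v₀, hv₀⟩ := htail
  refine ⟨max v₀ 0 * (1 + R), fun k i => ?_⟩
  have hle := hM.history_le k
  have hD : MeasurableSet[history x M k] {ω | ‖x k ω‖ ≤ R} :=
    hxm k (measurableSet_le measurable_norm measurable_const)
  have hMint : Integrable (M (k + 1)) μ := (hM.memLp k).integrable one_le_two
  have hWint : Integrable (truncatedNoise x M R k) μ := hMint.indicator (hle _ hD)
  have hWm : Measurable (truncatedNoise x M R k) := (hM.measurable k).indicator (hle _ hD)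
  have hproj : ∀ v : Space d, v i = EuclideanSpace.proj (𝕜 := ℝ) i v := fun v => rfl
  refine ⟨?_, ?_, fun A hA => ?_, fun v hv A hA => ?_⟩
  · simp only [hproj]
    exact (EuclideanSpace.proj (𝕜 := ℝ) i).continuous.measurable.comp hWm
  · simp only [hproj]
    exact (EuclideanSpace.proj (𝕜 := ℝ) i).integrable_comp hWint
  · simp only [hproj]
    rw [ContinuousLinearMap.integral_comp_comm _ hWint.integrableOn]
    have h1 : ∫ ω in A, truncatedNoise x M R k ω ∂μ = 0 := by
      rw [truncatedNoise, setIntegral_indicator (hle _ hD),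
        ← setIntegral_condExp hle hMint (MeasurableSet.inter hA hD)]
      rw [integral_congr_ae (ae_restrict_of_ae (hM.condExp_eq_zero k))]
      simp
    rw [h1, map_zero]
  · have hR1 : 0 < 1 + R := by linarith
    set v' := v / (1 + R) with hv'
    have hv'0 : max v₀ 0 ≤ v' := (le_div_iff₀ hR1).2 hv
    set D' : Set Ω := {ω | v' < ‖M (k + 1) ω‖ / (1 + ‖x k ω‖)} with hD'
    have hxm' : Measurable (x k) := (hxm k).mono hle le_rfl
    have hD'm : MeasurableSet D' := measurableSet_lt measurable_const
      ((hM.measurable k).norm.div (hxm'.norm.const_add 1))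
    have hsub : A ∩ {ω | v < |truncatedNoise x M R k ω i|} ⊆ A ∩ D' := by
      rintro ω ⟨hωA, hω⟩
      refine ⟨hωA, ?_⟩
      have hv0 : 0 ≤ v := (mul_nonneg (le_max_right _ _) hR1.le).trans hv
      have hω' : v < |truncatedNoise x M R k ω i| := hω
      by_cases hωD : ω ∈ {ω | ‖x k ω‖ ≤ R}
      · rw [truncatedNoise, Set.indicator_of_mem hωD] at hω'
        have h1 : |M (k + 1) ω i| ≤ ‖M (k + 1) ω‖ := PiLp.norm_apply_le (M (k + 1) ω) i
        have h2 : ‖x k ω‖ ≤ R := hωD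
        show v / (1 + R) < ‖M (k + 1) ω‖ / (1 + ‖x k ω‖)
        calc v / (1 + R) ≤ v / (1 + ‖x k ω‖) := by gcongr
          _ < _ := by gcongr; exact hω'.trans_le h1
      · rw [truncatedNoise, Set.indicator_of_notMem hωD] at hω'
        simp only [PiLp.zero_apply, abs_zero] at hω'
        linarith
    have hreal : μ.real (A ∩ D') ≤ C₁ * Real.exp (-C₂ * v') * μ.real A := by
      have hint : Integrable (D'.indicator fun _ => (1 : ℝ)) μ :=
        (integrable_const 1).indicator hD'm
      calc μ.real (A ∩ D') = ∫ ω in A, D'.indicator (fun _ => (1 : ℝ)) ω ∂μ := by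
            rw [setIntegral_indicator hD'm]; simp
        _ = ∫ ω in A, (μ[D'.indicator (fun _ => (1 : ℝ)) | history x M k]) ω ∂μ :=
            (setIntegral_condExp hle hint hA).symm
        _ ≤ ∫ _ in A, C₁ * Real.exp (-C₂ * v') ∂μ :=
            integral_mono_ae integrable_condExp.integrableOn (integrable_const _)
              (ae_restrict_of_ae (hv₀ v' ((le_max_left _ _).trans hv'0) k))
        _ = _ := by simp [mul_comm]
    calc _ ≤ μ (A ∩ D') := measure_mono hsub
      _ = ENNReal.ofReal (μ.real (A ∩ D')) := (ofReal_measureReal).symm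
      _ ≤ ENNReal.ofReal (C₁ * Real.exp (-C₂ * v') * μ.real A) := ENNReal.ofReal_le_ofReal hreal
      _ = ENNReal.ofReal (C₁ * Real.exp (-(C₂ / (1 + R)) * v)) * μ A := by
          rw [ENNReal.ofReal_mul' measureReal_nonneg, ofReal_measureReal,
            show -(C₂ / (1 + R)) * v = -C₂ * v' by rw [hv']; ring]

/-- A union bound over the coordinates and both signs, each at level `ε / (d + 1)`; using `d + 1` in
place of `d` also covers dimension zero. -/
theorem exists_truncatedNoise_bound [IsProbabilityMeasure μ] (hM : IsNoise μ x M)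
    (hxm : ∀ n, Measurable[history x M n] (x n)) {C₁ C₂ : ℝ} (hC₁ : 0 < C₁) (hC₂ : 0 < C₂)
    (htail : ExpTail μ x M C₁ C₂) {a : ℕ → ℝ} (ha : IsStepSize a) {R : ℝ} (hR : 0 ≤ R) :
    ∃ C > 0, ∃ κ > 0, ∀ m A, MeasurableSet[history x M m] A → ∀ ε > 0,
      μ (A ∩ {ω | ∃ n, ε ≤ ‖∑ k ∈ Finset.range n, a (m + k) • truncatedNoise x M R (m + k) ω‖})
        ≤ ENNReal.ofReal (C * Real.exp (-(κ * ε / Real.sqrt (tailSq a m)))) * μ A := by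
  obtain ⟨v₀, hv₀⟩ := exists_isSubexponential hM hxm htail hR
  have hC₂' : 0 < C₂ / (1 + R) := by positivity
  obtain ⟨K, hK, hmax⟩ := exists_maximal_bound hC₁ hC₂' v₀
  have hd : (0 : ℝ) < d + 1 := by positivity
  refine ⟨2 * (d + 1) * K, by positivity, C₂ / (1 + R) / 4 / (d + 1), by positivity, ?_⟩
  intro m A hA ε hε
  set q := K * Real.exp (-(C₂ / (1 + R) / 4 * (ε / (d + 1)) / Real.sqrt (tailSq a m))) with hq
  have hq0 : 0 ≤ q := by positivity
  set f : Fin d → ℕ → Ω → ℝ := fun i k ω => truncatedNoise x M R (m + k) ω i with hf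
  have hfm : ∀ i k, Measurable[history x M (m + (k + 1))] (f i k) := by
    intro i k
    have hD : MeasurableSet[history x M (m + k)] {ω | ‖x (m + k) ω‖ ≤ R} :=
      hxm (m + k) (measurableSet_le measurable_norm measurable_const)
    exact (EuclideanSpace.proj (𝕜 := ℝ) i).continuous.measurable.comp
      ((measurable_history_noise x M (m + k)).indicator (history_mono x M (Nat.le_succ _) _ hD))
  have hmono : Monotone fun k => history x M (m + k) :=
    fun i j hij => history_mono x M (Nat.add_le_add_left hij m)
  have hpos : ∀ i, μ (A ∩ {ω | ∃ n, ε / (d + 1) ≤ ∑ k ∈ Finset.range n, a (m + k) * f i k ω})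
      ≤ ENNReal.ofReal q * μ A := fun i =>
    hmax μ (fun k => history x M (m + k)) (f i) (fun k => a (m + k)) (tailSq a m) hmono
      (fun k => hM.history_le _) (fun k => hv₀ (m + k) i) (hfm i) (fun k => (ha.pos _).le)
      (ha.tailSq_pos m) (ha.sum_sq_le_tailSq m) A hA _
  have hneg : ∀ i, μ (A ∩ {ω | ∃ n, ε / (d + 1) ≤ ∑ k ∈ Finset.range n, a (m + k) * (-f i k) ω})
      ≤ ENNReal.ofReal q * μ A := fun i =>
    hmax μ (fun k => history x M (m + k)) (fun k => -f i k) (fun k => a (m + k)) (tailSq a m) hmono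
      (fun k => hM.history_le _) (fun k => (hv₀ (m + k) i).neg) (fun k => (hfm i k).neg)
      (fun k => (ha.pos _).le) (ha.tailSq_pos m) (ha.sum_sq_le_tailSq m) A hA _
  have hsub : A ∩ {ω | ∃ n,
        ε ≤ ‖∑ k ∈ Finset.range n, a (m + k) • truncatedNoise x M R (m + k) ω‖} ⊆
      ⋃ i : Fin d, ((A ∩ {ω | ∃ n, ε / (d + 1) ≤ ∑ k ∈ Finset.range n, a (m + k) * f i k ω}) ∪
        (A ∩ {ω | ∃ n, ε / (d + 1) ≤ ∑ k ∈ Finset.range n, a (m + k) * (-f i k) ω})) := by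
    rintro ω ⟨hωA, n, hn⟩
    set v := ∑ k ∈ Finset.range n, a (m + k) • truncatedNoise x M R (m + k) ω with hv
    have hvi : ∀ i, v i = ∑ k ∈ Finset.range n, a (m + k) * f i k ω := fun i => by
      simp [hv, hf]
    obtain ⟨i, hi⟩ : ∃ i, ε / (d + 1) ≤ |v i| := by
      by_contra! hcon
      have h1 : ‖v‖ ≤ ∑ i, |v i| := by
        have h2 := (EuclideanSpace.basisFun (Fin d) ℝ).sum_repr v
        calc ‖v‖ = ‖∑ i, v i • EuclideanSpace.basisFun (Fin d) ℝ i‖ := by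
              conv_lhs => rw [← h2]
              simp
          _ ≤ ∑ i, |v i| := norm_sum_le_of_le _ fun i _ => by simp [norm_smul]
      have h3 : ∑ i, |v i| ≤ ∑ _i : Fin d, ε / (d + 1) := Finset.sum_le_sum fun i _ => (hcon i).le
      have h4 : ∑ _i : Fin d, ε / (d + 1) < ε := by
        simp only [Finset.sum_const, Finset.card_univ, Fintype.card_fin, nsmul_eq_mul]
        rw [mul_div_assoc', div_lt_iff₀ hd]
        nlinarith
      linarith
    refine Set.mem_iUnion.2 ⟨i, ?_⟩
    rcases le_abs.1 hi with hi | hi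
    · exact Or.inl ⟨hωA, n, by rwa [← hvi]⟩
    · refine Or.inr ⟨hωA, n, ?_⟩
      simp only [Pi.neg_apply, mul_neg, Finset.sum_neg_distrib, ← hvi]
      exact hi
  calc _ ≤ _ := measure_mono hsub
    _ ≤ ∑ i : Fin d, (ENNReal.ofReal q * μ A + ENNReal.ofReal q * μ A) :=
        (measure_iUnion_fintype_le μ _).trans <| Finset.sum_le_sum fun i _ =>
          (measure_union_le _ _).trans (add_le_add (hpos i) (hneg i))
    _ = ENNReal.ofReal (d * (q + q)) * μ A := by
        rw [Finset.sum_const, Finset.card_univ, Fintype.card_fin, nsmul_eq_mul, ← add_mul,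
          ← ENNReal.ofReal_add hq0 hq0, ← mul_assoc, ENNReal.ofReal_mul (Nat.cast_nonneg d),
          ENNReal.ofReal_natCast]
    _ ≤ _ := by
        refine mul_le_mul_left (ENNReal.ofReal_le_ofReal ?_) _
        calc (d : ℝ) * (q + q) ≤ (d + 1) * (q + q) := by gcongr; linarith
          _ = _ := by rw [hq]; ring_nf

/-- For fixed `ε`, the event that the sums from every start `m` reach `ε` has probability at most
the bound at each `m`, and that bound tends to `0`. Countably many `ε` suffice. -/
theorem ae_exists_truncatedNoise_le [IsProbabilityMeasure μ] (hM : IsNoise μ x M)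
    (hxm : ∀ n, Measurable[history x M n] (x n)) {C₁ C₂ : ℝ} (hC₁ : 0 < C₁) (hC₂ : 0 < C₂)
    (htail : ExpTail μ x M C₁ C₂) {a : ℕ → ℝ} (ha : IsStepSize a) {R : ℝ} (hR : 0 ≤ R) :
    ∀ᵐ ω ∂μ, ∀ ε > 0, ∃ m, ∀ n,
      ‖∑ k ∈ Finset.range n, a (m + k) • truncatedNoise x M R (m + k) ω‖ ≤ ε := by
  obtain ⟨C, hC, κ, hκ, hbound⟩ := exists_truncatedNoise_bound hM hxm hC₁ hC₂ htail ha hR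
  have hj : ∀ j : ℕ, ∀ᵐ ω ∂μ, ∃ m, ∀ n,
      ‖∑ k ∈ Finset.range n, a (m + k) • truncatedNoise x M R (m + k) ω‖ < 1 / ((j : ℝ) + 1) := by
    intro j
    have hε : (0 : ℝ) < 1 / ((j : ℝ) + 1) := by positivity
    rw [ae_iff]
    have hlim : Tendsto (fun m => ENNReal.ofReal
        (C * Real.exp (-(κ * (1 / ((j : ℝ) + 1)) / Real.sqrt (tailSq a m))))) atTop (𝓝 0) := by
      have h1 : Tendsto (fun m => Real.sqrt (tailSq a m)) atTop (𝓝[>] 0) := by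
        refine tendsto_nhdsWithin_iff.2 ⟨by simpa using (tendsto_tailSq a).sqrt,
          Eventually.of_forall fun m => Real.sqrt_pos.2 (ha.tailSq_pos m)⟩
      have h2 := (tendsto_inv_nhdsGT_zero.comp h1).const_mul_atTop
        (show 0 < κ * (1 / ((j : ℝ) + 1)) by positivity)
      have h3 := (Real.tendsto_exp_neg_atTop_nhds_zero.comp h2).const_mul C
      have h4 := ENNReal.tendsto_ofReal h3
      simpa [Function.comp_def, div_eq_mul_inv] using h4
    refine le_antisymm (ge_of_tendsto' hlim fun m => ?_) bot_le
    have := hbound m Set.univ MeasurableSet.univ _ hε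
    rw [measure_univ, mul_one, Set.univ_inter] at this
    refine (measure_mono fun ω hω => ?_).trans this
    simp only [Set.mem_ofPred_eq, not_exists, not_forall, not_lt] at hω
    exact hω m
  filter_upwards [ae_all_iff.2 hj] with ω hω ε hε
  obtain ⟨j, hjε⟩ := exists_nat_one_div_lt hε
  obtain ⟨m, hm⟩ := hω j
  exact ⟨m, fun n => (hm n).le.trans hjε.le⟩

/-- The lock-in probability of a trapping set. -/
theorem exists_lockIn_bound [IsProbabilityMeasure μ] {h : Space d → Space d} {L : ℝ≥0}
    (hL : LipschitzWith L h) {a : ℕ → ℝ} (ha : IsStepSize a)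
    (hx : ∀ n ω, x (n + 1) ω = x n ω + a n • (h (x n ω) + M (n + 1) ω))
    (hM : IsNoise μ x M) {C₁ C₂ : ℝ} (hC₁ : 0 < C₁) (hC₂ : 0 < C₂)
    (htail : ExpTail μ x M C₁ C₂) {T : ℝ} (hT : 0 < T) {G : Set (Space d)} {V : Space d → ℝ}
    (hV : IsLiapunov h G V) {B : Set (Space d)} (hBopen : IsOpen B)
    (hBbdd : Bornology.IsBounded B) (hBG : closure B ⊆ G) {δ : ℝ} (hδ : 0 < δ)
    (htraps : Traps h a T B δ) :
    ∃ C > 0, ∃ κ > 0, ∃ N : ℕ, ∀ n₀ ≥ N, μ {ω | x n₀ ω ∈ B} ≠ 0 →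
      1 - C * Real.exp (-(κ / Real.sqrt (tailSq a n₀)))
        ≤ (μ[|{ω | x n₀ ω ∈ B}]).real (convergesTo x (stationarySet h G V)) := by
  have hxm := measurable_history_iterate hL hx
  obtain ⟨R, hR, ε, hε, N, hdet⟩ := htraps.exists_trapping_constants hL ha hBbdd hT hδ
  obtain ⟨r, hr⟩ := hV.exists_sublevel_superset hBbdd hBG
  obtain ⟨C, hC, κ, hκ, hbound⟩ := exists_truncatedNoise_bound hM hxm hC₁ hC₂ htail ha hR
  refine ⟨C, hC, κ * ε, by positivity, N, fun n₀ hn₀ hA0 => ?_⟩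
  set A : Set Ω := {ω | x n₀ ω ∈ B} with hA
  have hAm : MeasurableSet[history x M n₀] A := hxm n₀ hBopen.measurableSet
  have hAm' : MeasurableSet A := hM.history_le n₀ A hAm
  set bad : Set Ω := {ω | ∃ n,
    ε ≤ ‖∑ k ∈ Finset.range n, a (n₀ + k) • truncatedNoise x M R (n₀ + k) ω‖} with hbad
  set conv := convergesTo x (stationarySet h G V) with hconv
  -- Avoiding `bad` at the fixed level `ε` confines the path; convergence also needs the almost sure
  -- vanishing of the noise tails.
  have hsub : ∀ᵐ ω ∂μ, ω ∈ A → ω ∈ (A ∩ conv) ∪ (A ∩ bad) := by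
    filter_upwards [ae_exists_truncatedNoise_le hM hxm hC₁ hC₂ htail ha hR] with ω hω hωA
    by_cases hωb : ω ∈ bad
    · exact Or.inr ⟨hωA, hωb⟩
    refine Or.inl ⟨hωA, ?_⟩
    have hsmall : ∀ n,
        ‖∑ k ∈ Finset.range n, a (n₀ + k) • truncatedNoise x M R (n₀ + k) ω‖ ≤ ε :=
      fun n => (not_le.1 fun hle => hωb ⟨n, hle⟩).le
    have hrec : ∀ k, ‖x k ω‖ ≤ R →
        x (k + 1) ω = x k ω + a k • h (x k ω) + a k • truncatedNoise x M R k ω := by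
      intro k hk
      rw [hx, truncatedNoise, Set.indicator_of_mem (show ω ∈ {ω | ‖x k ω‖ ≤ R} from hk), smul_add,
        add_assoc]
    obtain ⟨hbd, hvisit⟩ := hdet n₀ hn₀ (fun k => x k ω)
      (fun k => a k • truncatedNoise x M R k ω) (fun k _ hk => hrec k hk) hsmall hωA
    refine hV.tendsto_infDist hL ha (y := fun k => x k ω) (r := r) (fun S η hη => ?_) fun N' => ?_
    · exact exists_forall_norm_sub_flow_le hL ha hbd (fun k hk => hrec k (hbd k hk)) hω S hη
    · obtain ⟨n, hn, hyn⟩ := hvisit N'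
      exact ⟨n, hn, hr hyn⟩
  have hle : μ A ≤ μ (A ∩ conv) + μ (A ∩ bad) :=
    (measure_mono_ae hsub).trans (measure_union_le _ _)
  have hbadle := hbound n₀ A hAm ε hε
  have hleR : μ.real A ≤ μ.real (A ∩ conv)
      + C * Real.exp (-(κ * ε / Real.sqrt (tailSq a n₀))) * μ.real A := by
    have h1 := ENNReal.toReal_mono
      (ENNReal.add_ne_top.2 ⟨measure_ne_top _ _,
        ENNReal.mul_ne_top ENNReal.ofReal_ne_top (measure_ne_top _ _)⟩)
      (hle.trans (add_le_add le_rfl hbadle))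
    rwa [ENNReal.toReal_add (measure_ne_top _ _)
      (ENNReal.mul_ne_top ENNReal.ofReal_ne_top (measure_ne_top _ _)), ENNReal.toReal_mul,
      ENNReal.toReal_ofReal (by positivity)] at h1
  have hApos : 0 < μ.real A := ENNReal.toReal_pos hA0 (measure_ne_top _ _)
  have hcond : (μ[|A]).real conv = μ.real (A ∩ conv) / μ.real A := by
    rw [Measure.real, cond_apply hAm', ENNReal.toReal_mul, ENNReal.toReal_inv, div_eq_inv_mul]
    rfl
  rw [hcond, le_div_iff₀ hApos]
  linarith

end Noise

end StochApprox

theorem mainTheorem1 {Ω : Type*} [MeasurableSpace Ω] (μ : Measure Ω) [IsProbabilityMeasure μ]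
    {d : ℕ} (h : StochApprox.Space d → StochApprox.Space d) (L : ℝ≥0) (hL : LipschitzWith L h)
    (a : ℕ → ℝ) (ha : StochApprox.IsStepSize a)
    (x M : ℕ → Ω → StochApprox.Space d)
    (hx : ∀ n ω, x (n + 1) ω = x n ω + a n • (h (x n ω) + M (n + 1) ω))
    (hM : StochApprox.IsNoise μ x M)
    (C₁ C₂ : ℝ) (hC₁ : 0 < C₁) (hC₂ : 0 < C₂) (htail : StochApprox.ExpTail μ x M C₁ C₂)
    (T : ℝ) (hT : 0 < T) (γ : ℝ) (hγ : 0 < γ) (hstep : StochApprox.LipschitzSteps a T γ)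
    (G : Set (StochApprox.Space d)) (V : StochApprox.Space d → ℝ)
    (hV : StochApprox.IsLiapunov h G V)
    (B : Set (StochApprox.Space d)) (hBopen : IsOpen B) (hBbdd : Bornology.IsBounded B)
    (hHB : StochApprox.stationarySet h G V ⊆ B) (hBG : closure B ⊆ G) :
    -- the bound, for every `δ_B` with the trapping property
    (∃ c > 0, ∃ c₁ > 0, ∀ δB > 0, StochApprox.Traps h a T B δB →
      ∃ N : ℕ, ∀ n₀ ≥ N, μ {ω | x n₀ ω ∈ B} ≠ 0 →
        1 - c₁ * Real.exp (-(c * (δB / (2 * StochApprox.gronwallConst L T)) ^ (2 / 3 : ℝ)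
            / StochApprox.tailSq a n₀ ^ (1 / 4 : ℝ)))
          ≤ (μ[|{ω | x n₀ ω ∈ B}]).real
              (StochApprox.convergesTo x (StochApprox.stationarySet h G V))) ∧
    -- such a `δ_B` exists for all large enough block lengths
    (∃ T₀ > 0, ∀ T' ≥ T₀, ∃ δB > 0, StochApprox.Traps h a T' B δB) ∧
    -- the resulting order of the error probability, whatever the block length `T`
    (∃ c > 0, ∃ c₁ > 0, ∃ N : ℕ, ∀ n₀ ≥ N, μ {ω | x n₀ ω ∈ B} ≠ 0 →
      1 - c₁ * Real.exp (-(c / StochApprox.tailSq a n₀ ^ (1 / 4 : ℝ)))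
        ≤ (μ[|{ω | x n₀ ω ∈ B}]).real
            (StochApprox.convergesTo x (StochApprox.stationarySet h G V))) := by
  have key : ∀ T' > 0, ∀ δB > 0, StochApprox.Traps h a T' B δB → ∀ q : ℝ, ∃ N : ℕ, ∀ n₀ ≥ N,
      μ {ω | x n₀ ω ∈ B} ≠ 0 →
        1 - 1 * Real.exp (-(q / StochApprox.tailSq a n₀ ^ (1 / 4 : ℝ)))
          ≤ (μ[|{ω | x n₀ ω ∈ B}]).real
              (StochApprox.convergesTo x (StochApprox.stationarySet h G V)) := by
    intro T' hT' δB hδB htraps q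
    obtain ⟨C, hC, κ, hκ, N₁, hN₁⟩ := StochApprox.exists_lockIn_bound hL ha hx hM hC₁ hC₂ htail
      hT' hV hBopen hBbdd hBG hδB htraps
    obtain ⟨N₂, hN₂⟩ := ha.exists_exp_tailSq_le hC hκ q
    refine ⟨max N₁ N₂, fun n₀ hn₀ hne => ?_⟩
    linarith [hN₁ n₀ ((le_max_left _ _).trans hn₀) hne, hN₂ n₀ ((le_max_right _ _).trans hn₀)]
  have htraps := hV.exists_traps hL ha hBopen hBbdd hHB hBG
  -- Since `q` in `key` is arbitrary, it can be the whole power of `δB`, so the constants `1` serve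
  -- all `δB`; only the threshold index depends on `δB`.
  refine ⟨⟨1, one_pos, 1, one_pos, fun δB hδB hδ => ?_⟩, htraps, ?_⟩
  · rw [one_mul]
    exact key T hT δB hδB hδ _
  -- Neither side of this bound involves the block length, so blocks of length `T₀`, for which
  -- trapping is known, may be used.
  · obtain ⟨T₀, hT₀, hall⟩ := htraps
    obtain ⟨δB, hδB, hδ⟩ := hall T₀ le_rfl
    exact ⟨1, one_pos, 1, one_pos, key T₀ hT₀ δB hδB hδ 1⟩
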